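/- \textbf{Setting.} Fix a horizon $T\ge 1$, measurable spaces $\mathcal O_t$ (observed features), $\mathcal U_t$ (latent features) and finite action sets $\mathcal A_t$. For a sequence write $x_{1:t}=(x_1,\dots,x_t)$. A confounded decision process consists, for each $t$, of Markov kernels giving: the law of $U_t$ given $(U_{1:t-1},O_{1:t-1})$ and the past actions taken; the law of $O_t$ given $U_{1:t}$ (so $O_t$ is a noisy mapping of $U_{1:t}$); the behavior policy $\pi^b_t(\cdot\mid U_{1:t},\text{past actions taken})$ on $\mathcal A_t$; and the law of the reward $R_t$ given $(U_{1:t},O_{1:t})$ and the actions taken up to time $t$, with $|R_t|\le R_{\max}$. \emph{Offline law} ($\mathbb P,\mathbb E$). The actions taken $A_t$ are generated by $\pi^b$, and $O_0$ is an additional observation collected before the process starts; $A_t$ has conditional law $\pi^b_t(\cdot\mid U_{1:t},A_{1:t-1})$ given $(O_0,U_{1:t},O_{1:t},A_{1:t-1})$. The variables are defined on a standard Borel probability space. \emph{Policies.} $\Omega$ is the set of all $\nu=(\nu_t)_{t\le T}$, $\nu_t:\mathcal O_{1:t}\times\mathcal A_{1:t-1}\times\mathcal A_{1:t}\to\mathcal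 P(\mathcal A_t)$. When $\nu$ acts (law $\mathbb P^\nu$), at each time $t$ the behavior policy proposes $A_t\sim\pi^b_t(\cdot\mid U_{1:t},A^\nu_{1:t-1})$, the action $A^\nu_t\sim\nu_t(\cdot\mid O_{1:t},A^\nu_{1:t-1},A_{1:t})$ is taken, and rewards and features follow the actions $A^\nu$ taken. The value is $\mathcal V(\nu)=\mathbb E^\nu[\sum_{t=1}^T R_t]$. \textbf{Assumptions.} (1) For $t=1,\dots,T$: $O_0\perp\!\!\!\perp (R_t,O_{t+1},O_t,U_{t+1})\mid (U_{1:t},O_{1:t-1},A_{1:t})$. (2) Every $\nu\in\Omega$ has value bridge functions $b^\nu_t(a,(o_{1:t-1},a^\nu_{1:t-1}),o_t,a_{1:t})$, $t=1,\dots,T$. This means: $b^\nu_t(a,(O_{1:t-1},A_{1:t-1}),O_t,a_{1:t})$ is measurable and square-integrable for all fixed $a,a_{1:t}$, and for all $a_{1:t}\in\mathcal A_{1:t}$, $a\in\mathcal A_t$ and almost every $(u_{1:t},o_{1:t-1},a^\nu_{1:t-1})$ under the offline law of $(U_{1:t},O_{1:t-1},A_{1:t-1})$, $$\mathbb E^\nu\Big\{\Big(\sum_{t'=t}^T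 R_{t'}\Big)\nu_t(a\mid O_t,o_{1:t-1},a^\nu_{1:t-1},a_{1:t})\,\Big|\,u_{1:t},(o_{1:t-1},a^\nu_{1:t-1}),A_{1:t}=a_{1:t},A^\nu_t:=a\Big\}=\mathbb E\{b^\nu_t(a,(o_{1:t-1},a^\nu_{1:t-1}),O_t,a_{1:t})\mid U_{1:t}=u_{1:t}\}.$$ Here $A^\nu_t:=a$ means that the action taken at time $t$ is set to $a$: $O_t$ is drawn from its law given $u_{1:t}$, the action $a$ is taken, and $\nu$ acts at all later times. (3) Completeness: for every $t\le T$, $a\in\mathcal A_t$ and measurable $g$ with $g(U_{1:t},O_{1:t-1},A_{1:t-1})$ square-integrable, $\mathbb E\{g(U_{1:t},O_{1:t-1},A_{1:t-1})\mid O_{1:t-1},A_{1:t-1},O_0,A_t=a\}=0$ a.s. under $\mathbb P(\cdot\mid A_t=a)$ (a condition regarded as vacuously true if $\mathbb P(A_t=a)=0$) if and only if $g(U_{1:t},O_{1:t-1},A_{1:t-1})=0$ $\mathbb P$-a.s. \textbf{Theorem.} Let $\nu\in\Omega$. Consider the backward system, for $t=T,\dots,1$ and all $a_{1:t}\in\mathcal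 A_{1:t}$, $a\in\mathcal A_t$, with $b_{T+1}=0$: $$\mathbb E\Big\{b_t(a,(O_{1:t-1},A_{1:t-1}),O_t,a_{1:t})-\Big[R_t+\sum_{a'\in\mathcal A_{t+1}}b_{t+1}(a',(O_{1:t},A_{1:t}),O_{t+1},(a_{1:t},A_{t+1}))\Big]\nu_t(a\mid (O_{1:t-1},A_{1:t-1}),O_t,a_{1:t})\,\Big|\,O_0,(O_{1:t-1},A_{1:t-1}),A_t=a\Big\}=0,$$ in unknown functions $b_1,\dots,b_T$ such that each $b_t(a,(O_{1:t-1},A_{1:t-1}),O_t,a_{1:t})$ is measurable and square-integrable. Then the system has a solution; a sequence $b$ solves the system if and only if it is a sequence of value bridge functions of $\nu$; and for every solution $b$, $$\mathcal V(\nu)=\mathbb E\Big[\sum_{a\in\mathcal A_1}b_1(a,O_1,A_1)\Big].$$ -/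

import Mathlib

open MeasureTheory ProbabilityTheory
open scoped BigOperators

noncomputable section

/- Time is indexed from `0`: the decision points are `0, …, T - 1`, so the `t`-th decision
point (`t = 1, …, T`) has index `k = t - 1`. The space of a feature at time `k` is `X k`; the spaces with index
beyond the horizon play no role. -/

/-- The values of a sequence at the first `k` time points, indices `0, …, k - 1`. -/
abbrev Past (X : ℕ → Type*) (k : ℕ) : Type _ := ∀ i : Fin k, X i

/-- Append the value at time `k`. -/
def Past.snoc {X : ℕ → Type*} {k : ℕ} (p : Past X k) (x : X k) : Past X (k + 1) :=
  Fin.snoc (α := fun i : Fin (k + 1) => X i) p x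

/-- The first `k` variables of a sequence of random variables. -/
def pastOf {Ω : Type*} {X : ℕ → Type*} (V : ∀ k, Ω → X k) (k : ℕ) (ω : Ω) : Past X k :=
  fun i => V i ω

theorem measurable_snoc {X : ℕ → Type*} [∀ k, MeasurableSpace (X k)] {k : ℕ} :
    Measurable fun q : Past X k × X k => Past.snoc q.1 q.2 := by
  refine measurable_pi_iff.2 fun i => ?_
  refine Fin.lastCases ?_ (fun j => ?_) i
  · have h : (fun q : Past X k × X k => Past.snoc q.1 q.2 (Fin.last k)) = fun q => q.2 := by
      funext q; simp [Past.snoc]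
    rw [h]; exact measurable_snd
  · have h : (fun q : Past X k × X k => Past.snoc q.1 q.2 j.castSucc) = fun q => q.1 j := by
      funext q; simp [Past.snoc]
    rw [h]; exact (measurable_pi_apply j).comp measurable_fst

@[fun_prop]
theorem Measurable.pastSnoc {X : ℕ → Type*} [∀ k, MeasurableSpace (X k)] {k : ℕ} {α : Type*}
    [MeasurableSpace α] {f : α → Past X k} {g : α → X k} (hf : Measurable f) (hg : Measurable g) :
    Measurable fun a => Past.snoc (f a) (g a) :=
  measurable_snoc.comp (hf.prodMk hg)

@[fun_prop]
theorem measurable_pastOf {Ω : Type*} [MeasurableSpace Ω] {X : ℕ → Type*}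
    [∀ k, MeasurableSpace (X k)] {V : ∀ k, Ω → X k} (hV : ∀ k, Measurable (V k)) (k : ℕ) :
    Measurable (pastOf V k) :=
  measurable_pi_iff.2 fun i => hV i

section Model

variable (O U A : ℕ → Type*) [∀ k, MeasurableSpace (O k)] [∀ k, MeasurableSpace (U k)]
  [∀ k, MeasurableSpace (A k)]

/-- An episodic confounded decision process together with its behavior policy.
`latent k` is the law of `U_k` given the past latent features, observations and actions taken
(for `k = 0` it is the initial law), `emission k` is the noisy mapping that produces `O_k` from
`U_{0:k}`, `behavior k` is the behavior policy, which sees `U_{0:k}` and the past actions taken,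
and `reward k` is the law of the reward given the features and the actions taken up to `k`. -/
structure ConfoundedProcess where
  latent : ∀ k, Kernel (Past U k × Past O k × Past A k) (U k)
  emission : ∀ k, Kernel (Past U (k + 1)) (O k)
  behavior : ∀ k, Kernel (Past U (k + 1) × Past A k) (A k)
  reward : ∀ k, Kernel (Past U (k + 1) × Past O (k + 1) × Past A (k + 1)) ℝ
  latent_markov : ∀ k, IsMarkovKernel (latent k)
  emission_markov : ∀ k, IsMarkovKernel (emission k)
  behavior_markov : ∀ k, IsMarkovKernel (behavior k)
  reward_markov : ∀ k, IsMarkovKernel (reward k)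
  rewardBound : ℝ
  reward_le : ∀ k x, ∀ᵐ r ∂(reward k x), |r| ≤ rewardBound

/-- The policy class `Ω`: at time `k` the policy sees the observations `O_{0:k}`, the actions
`A^ν_{0:k-1}` it has taken itself, and the actions `A_{0:k}` proposed by the behavior policy. -/
structure SuperPolicy where
  kernel : ∀ k, Kernel (Past O (k + 1) × Past A k × Past A (k + 1)) (A k)
  markov : ∀ k, IsMarkovKernel (kernel k)

/-- One step of the process in which a super-policy acts:
`((((u, o), proposed action), action taken), reward)`. -/
abbrev Step (k : ℕ) : Type _ := (((U k × O k) × A k) × A k) × ℝ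

/-- The first `k` steps of the process in which a super-policy acts. -/
abbrev Traj (k : ℕ) : Type _ := Past (Step O U A) k

attribute [instance] ConfoundedProcess.latent_markov ConfoundedProcess.emission_markov
  ConfoundedProcess.behavior_markov ConfoundedProcess.reward_markov SuperPolicy.markov

end Model

section Law

variable {O U A : ℕ → Type*} [∀ k, MeasurableSpace (O k)] [∀ k, MeasurableSpace (U k)]
  [∀ k, MeasurableSpace (A k)]

/-- `ν_k(a | o_{0:k}, a^ν_{0:k-1}, a_{0:k})`. -/
def SuperPolicy.prob (ν : SuperPolicy O A) (k : ℕ) (a : A k) (o : Past O (k + 1))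
    (taken : Past A k) (prop : Past A (k + 1)) : ℝ :=
  (ν.kernel k (o, taken, prop)).real {a}

def pathU {k : ℕ} (h : Traj O U A k) : Past U k := fun i => (h i).1.1.1.1
def pathO {k : ℕ} (h : Traj O U A k) : Past O k := fun i => (h i).1.1.1.2
def pathProposed {k : ℕ} (h : Traj O U A k) : Past A k := fun i => (h i).1.1.2
def pathTaken {k : ℕ} (h : Traj O U A k) : Past A k := fun i => (h i).1.2
def pathReward {k : ℕ} (h : Traj O U A k) (i : Fin k) : ℝ := (h i).2

@[fun_prop]
theorem measurable_pathU {k : ℕ} : Measurable (pathU : Traj O U A k → _) := by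
  unfold pathU; fun_prop
@[fun_prop]
theorem measurable_pathO {k : ℕ} : Measurable (pathO : Traj O U A k → _) := by
  unfold pathO; fun_prop
@[fun_prop]
theorem measurable_pathProposed {k : ℕ} : Measurable (pathProposed : Traj O U A k → _) := by
  unfold pathProposed; fun_prop
@[fun_prop]
theorem measurable_pathTaken {k : ℕ} : Measurable (pathTaken : Traj O U A k → _) := by
  unfold pathTaken; fun_prop

/-- The law of step `k` given the first `k` steps when the super-policy `ν` acts: the latent
feature follows the transition law driven by the actions taken, the observation is emitted, the
behavior policy proposes an action (it sees the actions taken so far), `ν` chooses the action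
taken, and the reward follows. -/
def stepLaw (M : ConfoundedProcess O U A) (ν : SuperPolicy O A) (k : ℕ) :
    Kernel (Traj O U A k) (Step O U A k) :=
  (((((M.latent k).comap (fun h => (pathU h, pathO h, pathTaken h)) (by fun_prop)) ⊗ₖ
    ((M.emission k).comap (fun x : Traj O U A k × U k => Past.snoc (pathU x.1) x.2)
      (by fun_prop))) ⊗ₖ
    ((M.behavior k).comap (fun x : Traj O U A k × (U k × O k) =>
      (Past.snoc (pathU x.1) x.2.1, pathTaken x.1)) (by fun_prop))) ⊗ₖ
    ((ν.kernel k).comap (fun x : Traj O U A k × ((U k × O k) × A k) =>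
      (Past.snoc (pathO x.1) x.2.1.2, pathTaken x.1, Past.snoc (pathProposed x.1) x.2.2))
      (by fun_prop))) ⊗ₖ
    ((M.reward k).comap (fun x : Traj O U A k × (((U k × O k) × A k) × A k) =>
      (Past.snoc (pathU x.1) x.2.1.1.1, Past.snoc (pathO x.1) x.2.1.1.2,
        Past.snoc (pathTaken x.1) x.2.2)) (by fun_prop))

/-- The law of the first `k + n` steps under `ν`, given the first `k` steps. -/
def pathLaw (M : ConfoundedProcess O U A) (ν : SuperPolicy O A) (k : ℕ) :
    (n : ℕ) → Kernel (Traj O U A k) (Traj O U A (k + n))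
  | 0 => Kernel.id
  | n + 1 =>
    ((Kernel.id ×ₖ stepLaw M ν (k + n)).map fun q => Past.snoc q.1 q.2) ∘ₖ pathLaw M ν k n

/-- The sum of the rewards from time `k` on. -/
def returnFrom (k : ℕ) {n : ℕ} (h : Traj O U A n) : ℝ :=
  ∑ i : Fin n, if k ≤ (i : ℕ) then pathReward h i else 0

/-- The policy value: the expectation of the total reward when `ν` acts throughout. -/
def value (M : ConfoundedProcess O U A) (T : ℕ) (ν : SuperPolicy O A) : ℝ :=
  ∫ h, returnFrom 0 h ∂(pathLaw M ν 0 T fun i => i.elim0)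

/-- The law of the whole process given `U_{0:k} = u`, `O_{0:k-1} = o`, `A^ν_{0:k-1} = taken` and
`A_{0:k} = prop`, when the action taken at time `k` is set to `a` and `ν` acts at all later
times. The rewards before time `k` have no influence and are set to `0`. -/
def lawSetting (M : ConfoundedProcess O U A) (T : ℕ) (ν : SuperPolicy O A) (k : ℕ)
    (u : Past U (k + 1)) (o : Past O k) (taken : Past A k) (prop : Past A (k + 1)) (a : A k) :
    Measure (Traj O U A (k + 1 + (T - (k + 1)))) :=
  (M.emission k u).bind fun x =>
    (M.reward k (u, Past.snoc o x, Past.snoc taken a)).bind fun r =>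
      pathLaw M ν (k + 1) (T - (k + 1)) fun i =>
        ((((u i, Past.snoc o x i), prop i), Past.snoc taken a i), if (i : ℕ) = k then r else 0)

/-- `E^ν[(∑_{t ≥ k} R_t) ν_k(a | O_k, o, taken, prop)]` under `lawSetting`. -/
def weightedReturn (M : ConfoundedProcess O U A) (T : ℕ) (ν : SuperPolicy O A) (k : ℕ)
    (u : Past U (k + 1)) (o : Past O k) (taken : Past A k) (prop : Past A (k + 1)) (a : A k) : ℝ :=
  ∫ h, returnFrom k h * ν.prob k a (Past.snoc o (h ⟨k, by omega⟩).1.1.1.2) taken prop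
    ∂(lawSetting M T ν k u o taken prop a)

end Law

section Data

variable {O U A : ℕ → Type*} [∀ k, MeasurableSpace (O k)] [∀ k, MeasurableSpace (U k)]
  [∀ k, MeasurableSpace (A k)]

/-- The offline process: random variables on `(Ω, P)` that follow the process `M` up to the
horizon `T` with all actions generated by the behavior policy, and an observation `O₀` collected
before the process starts. -/
structure OfflineData (M : ConfoundedProcess O U A) (T : ℕ) (O₀ : Type*) [MeasurableSpace O₀]
    {Ω : Type*} [MeasurableSpace Ω] (P : Measure Ω) where
  obs₀ : Ω → O₀
  obs : ∀ k, Ω → O k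
  lat : ∀ k, Ω → U k
  act : ∀ k, Ω → A k
  rew : ℕ → Ω → ℝ
  measurable_obs₀ : Measurable obs₀
  measurable_obs : ∀ k, Measurable (obs k)
  measurable_lat : ∀ k, Measurable (lat k)
  measurable_act : ∀ k, Measurable (act k)
  measurable_rew : ∀ k, Measurable (rew k)
  law_lat : ∀ k < T, HasCondDistrib (lat k)
    (fun ω => (pastOf lat k ω, pastOf obs k ω, pastOf act k ω)) (M.latent k) P
  law_obs : ∀ k < T, HasCondDistrib (obs k)
    (fun ω => (pastOf lat (k + 1) ω, pastOf obs k ω, pastOf act k ω))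
    ((M.emission k).comap (fun x : Past U (k + 1) × Past O k × Past A k => x.1)
      (by fun_prop)) P
  law_act : ∀ k < T, HasCondDistrib (act k)
    (fun ω => ((pastOf lat (k + 1) ω, pastOf act k ω), pastOf obs (k + 1) ω, obs₀ ω))
    ((M.behavior k).comap
      (fun x : (Past U (k + 1) × Past A k) × Past O (k + 1) × O₀ => x.1) (by fun_prop)) P
  law_rew : ∀ k < T, HasCondDistrib (rew k)
    (fun ω => (pastOf lat (k + 1) ω, pastOf obs (k + 1) ω, pastOf act (k + 1) ω)) (M.reward k) P

variable {M : ConfoundedProcess O U A} {T : ℕ} {O₀ : Type*} [MeasurableSpace O₀]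
  {Ω : Type*} [MeasurableSpace Ω] {P : Measure Ω}

/-- `(U_{0:k}, O_{0:k-1}, A_{0:k})`. -/
def OfflineData.condVar (D : OfflineData M T O₀ P) (k : ℕ) (ω : Ω) :
    Past U (k + 1) × Past O k × Past A (k + 1) :=
  (pastOf D.lat (k + 1) ω, pastOf D.obs k ω, pastOf D.act (k + 1) ω)

theorem OfflineData.measurable_condVar (D : OfflineData M T O₀ P) (k : ℕ) :
    Measurable (D.condVar k) :=
  (measurable_pastOf D.measurable_lat _).prodMk
    ((measurable_pastOf D.measurable_obs _).prodMk (measurable_pastOf D.measurable_act _))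

/-- `O₀` is independent of `(R_k, O_{k+1}, O_k, U_{k+1})` given `(U_{0:k}, O_{0:k-1}, A_{0:k})`,
at every decision point. -/
def OfflineData.PreObservationIndep [StandardBorelSpace Ω] [IsFiniteMeasure P]
    (D : OfflineData M T O₀ P) : Prop :=
  ∀ k < T, CondIndepFun (MeasurableSpace.comap (D.condVar k) inferInstance)
    (D.measurable_condVar k).comap_le D.obs₀
    (fun ω => (D.rew k ω, D.obs (k + 1) ω, D.obs k ω, D.lat (k + 1) ω)) P

/-- The σ-algebra generated by `(O₀, O_{0:k-1}, A_{0:k-1})`. -/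
@[reducible] def OfflineData.sigma (D : OfflineData M T O₀ P) (k : ℕ) : MeasurableSpace Ω :=
  MeasurableSpace.comap (fun ω => (D.obs₀ ω, pastOf D.obs k ω, pastOf D.act k ω)) inferInstance

/-- Completeness: for every square-integrable `g(U_{0:k}, O_{0:k-1}, A_{0:k-1})` and action `a`,
`E[g | O_{0:k-1}, A_{0:k-1}, O₀, A_k = a] = 0` a.s. (under the law given `A_k = a`) if and only if
`g = 0` a.s. -/
def OfflineData.Complete (D : OfflineData M T O₀ P) : Prop :=
  ∀ k < T, ∀ a : A k, ∀ g : Past U (k + 1) × Past O k × Past A k → ℝ, Measurable g →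
    MemLp (fun ω => g (pastOf D.lat (k + 1) ω, pastOf D.obs k ω, pastOf D.act k ω)) 2 P →
    ((P[|D.act k ⁻¹' {a}])[fun ω =>
        g (pastOf D.lat (k + 1) ω, pastOf D.obs k ω, pastOf D.act k ω) | D.sigma k]
      =ᵐ[P[|D.act k ⁻¹' {a}]] 0 ↔
    (fun ω => g (pastOf D.lat (k + 1) ω, pastOf D.obs k ω, pastOf D.act k ω)) =ᵐ[P] 0)

variable (O A) in
/-- A sequence of functions `b_k(a, (o_{0:k-1}, a^ν_{0:k-1}), o_k, a_{0:k})`. -/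
abbrev BridgeFun : Type _ :=
  ∀ k, A k → Past O k → Past A k → O k → Past A (k + 1) → ℝ

/-- Measurability, and square integrability of `b_k(a, (O_{0:k-1}, A_{0:k-1}), O_k, a_{0:k})`. -/
def OfflineData.SquareIntegrable (D : OfflineData M T O₀ P) (b : BridgeFun O A) : Prop :=
  ∀ k < T, ∀ (a : A k) (prop : Past A (k + 1)),
    Measurable (fun z : Past O k × Past A k × O k => b k a z.1 z.2.1 z.2.2 prop) ∧
    MemLp (fun ω => b k a (pastOf D.obs k ω) (pastOf D.act k ω) (D.obs k ω) prop) 2 P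

/-- `b` is a sequence of value bridge functions of `ν`: for all `a_{0:k}` and `a`, for almost
every value of `(U_{0:k}, O_{0:k-1}, A^ν_{0:k-1})`, the weighted return with the action at time
`k` set to `a` is the mean of `b_k(a, ·, O_k, a_{0:k})` over `O_k`. -/
def OfflineData.IsValueBridge (D : OfflineData M T O₀ P) (ν : SuperPolicy O A)
    (b : BridgeFun O A) : Prop :=
  D.SquareIntegrable b ∧ ∀ k < T, ∀ (prop : Past A (k + 1)) (a : A k), ∀ᵐ ω ∂P,
    weightedReturn M T ν k (pastOf D.lat (k + 1) ω) (pastOf D.obs k ω) (pastOf D.act k ω) prop a =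
      ∫ x, b k a (pastOf D.obs k ω) (pastOf D.act k ω) x prop
        ∂(M.emission k (pastOf D.lat (k + 1) ω))

/-- `∑_{a'} b_{k+1}(a', (O_{0:k}, A_{0:k}), O_{k+1}, (a_{0:k}, A_{k+1}))`, and `0` if `k` is the
last decision point. -/
def OfflineData.nextBridge [∀ k, Fintype (A k)] (D : OfflineData M T O₀ P) (b : BridgeFun O A)
    (k : ℕ) (prop : Past A (k + 1)) (ω : Ω) : ℝ :=
  if k + 1 < T then
    ∑ a' : A (k + 1), b (k + 1) a' (pastOf D.obs (k + 1) ω) (pastOf D.act (k + 1) ω)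
      (D.obs (k + 1) ω) (Past.snoc prop (D.act (k + 1) ω))
  else 0

/-- `b` solves the backward conditional moment equations: for all `a_{0:k}` and `a`,
`E[b_k(a, ·, O_k, a_{0:k}) - (R_k + ∑_{a'} b_{k+1}(a', ·)) ν_k(a | ·) | O₀, O_{0:k-1}, A_{0:k-1},
A_k = a] = 0` almost surely. -/
def OfflineData.SolvesBridgeEquations [∀ k, Fintype (A k)] (D : OfflineData M T O₀ P)
    (ν : SuperPolicy O A) (b : BridgeFun O A) : Prop :=
  D.SquareIntegrable b ∧ ∀ k < T, ∀ (prop : Past A (k + 1)) (a : A k),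
    (P[|D.act k ⁻¹' {a}])[fun ω =>
        b k a (pastOf D.obs k ω) (pastOf D.act k ω) (D.obs k ω) prop -
          (D.rew k ω + D.nextBridge b k prop ω) *
            ν.prob k a (pastOf D.obs (k + 1) ω) (pastOf D.act k ω) prop | D.sigma k]
      =ᵐ[P[|D.act k ⁻¹' {a}]] 0

end Data

end

/-! Everything rests on a backward value recursion. `contValue` is the expected return of ν over the
remaining steps as a function of features, taken actions and proposed actions. `actionValue` is the
mean over O_k of ν_k(a | ·) times the reward mean plus continuation when a is taken. Fubini along
the path law (`integral_pathLaw_add`, `weightedReturn_eq`) identifies the left side of the bridge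
equation with `actionValue`. So b is a bridge at time k exactly when `bridgeGap`, the emission mean
of b_k minus `actionValue`, vanishes almost surely. This gap is a function of (U_{0:k}, O_{0:k-1},
A_{0:k-1}) only, the variables covered by completeness.

The central fact is `PreObservationIndep.condExp_residual`: if b is a bridge at time k+1, then given
(O₀, O_{0:k-1}, A_{0:k-1}) and A_k = a, the residual of the k-th equation has the same conditional
mean as `bridgeGap`. To see this, condition on the finer σ(U_{0:k}, O_{0:k-1}, A_{0:k}, O₀).
Independence removes O₀. The variable O_k keeps its emission law because A_k is drawn without
looking at it. The reward is replaced by its mean. The sum of the b_{k+1} is replaced by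
`contValue`: offline, A_{k+1} has the law of the proposal that ν would receive after the taken
actions A_{0:k}, and the bridge property then applies. On {A_k = a} the recorded history is the one
with taken action a, whatever proposals are held fixed.

A bridge therefore solves the system at once, and bridges exist by assumption, so a solution exists.
Conversely, for a solution, backward induction and completeness force each `bridgeGap` to vanish.
Finally, inserting the offline A_0 as the first proposal and averaging the sum of the b_0 gives
`contValue` over the whole horizon, which is the policy value. -/

noncomputable section

/-! ### Conditional expectations, conditional laws and conditional independence. -/

section Conditioning

theorem comap_le_comap_prodMk_left {Ω 𝓧 𝓨 : Type*} [MeasurableSpace 𝓧] [MeasurableSpace 𝓨]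
    (V : Ω → 𝓧) (Y : Ω → 𝓨) :
    MeasurableSpace.comap V inferInstance
      ≤ MeasurableSpace.comap (fun ω => (V ω, Y ω)) inferInstance := by
  rintro _ ⟨s, hs, rfl⟩
  exact ⟨Prod.fst ⁻¹' s, measurable_fst hs, rfl⟩

variable {Ω 𝓧 𝓨 𝓩 : Type*} [mΩ : MeasurableSpace Ω] [MeasurableSpace 𝓧] [MeasurableSpace 𝓨]
  [MeasurableSpace 𝓩] {P : Measure Ω}

/-- Integrals over the sets of `σ(X, Z)` are determined by those over rectangles. -/
theorem setIntegral_congr_of_rectangles {X : Ω → 𝓧} {Z : Ω → 𝓩} (hX : Measurable X)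
    (hZ : Measurable Z) {f g : Ω → ℝ} (hf : Integrable f P) (hg : Integrable g P)
    (h : ∀ S T, MeasurableSet S → MeasurableSet T →
      ∫ ω in X ⁻¹' S ∩ Z ⁻¹' T, f ω ∂P = ∫ ω in X ⁻¹' S ∩ Z ⁻¹' T, g ω ∂P)
    {s : Set (𝓧 × 𝓩)} (hs : MeasurableSet s) :
    ∫ ω in (fun ω => (X ω, Z ω)) ⁻¹' s, f ω ∂P = ∫ ω in (fun ω => (X ω, Z ω)) ⁻¹' s, g ω ∂P := by
  have hXZ : Measurable fun ω => (X ω, Z ω) := hX.prodMk hZ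
  have huniv : ∫ ω, f ω ∂P = ∫ ω, g ω ∂P := by
    simpa using h Set.univ Set.univ .univ .univ
  induction s, hs using MeasurableSpace.induction_on_inter generateFrom_prod.symm isPiSystem_prod with
  | empty => simp
  | basic t ht =>
    obtain ⟨S, hS, T, hT, rfl⟩ := ht
    exact h S T hS hT
  | compl t ht ih =>
    rw [Set.preimage_compl]
    have h1 := integral_add_compl (hXZ ht) hf
    have h2 := integral_add_compl (hXZ ht) hg
    linarith
  | iUnion t hd ht ih =>
    have hd' : Pairwise (Function.onFun Disjoint fun i => (fun ω => (X ω, Z ω)) ⁻¹' t i) :=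
      fun i j hij => (hd hij).preimage _
    rw [Set.preimage_iUnion, integral_iUnion (fun i => hXZ (ht i)) hd' hf.integrableOn,
      integral_iUnion (fun i => hXZ (ht i)) hd' hg.integrableOn]
    exact tsum_congr ih

/-- An integrable function of `(Y, V)` has the same conditional expectation given `(V, Z)` and
given `V` if `Z` and `Y` are independent given `V`. -/
theorem condExp_prodMk_of_condIndepFun [StandardBorelSpace Ω] [IsFiniteMeasure P]
    {V : Ω → 𝓧} {Y : Ω → 𝓨} {Z : Ω → 𝓩} (hV : Measurable V) (hY : Measurable Y)
    (hZ : Measurable Z)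
    (hind : CondIndepFun (MeasurableSpace.comap V inferInstance) hV.comap_le Z Y P)
    {F : 𝓧 × 𝓨 → ℝ} (hF : Measurable F) (hint : Integrable (fun ω => F (V ω, Y ω)) P) :
    P[fun ω => F (V ω, Y ω) | MeasurableSpace.comap (fun ω => (V ω, Z ω)) inferInstance]
      =ᵐ[P] P[fun ω => F (V ω, Y ω) | MeasurableSpace.comap V inferInstance] := by
  have hVY := hV.prodMk hY
  have hVZ := hV.prodMk hZ
  have hle : MeasurableSpace.comap V inferInstance ≤ mΩ := hV.comap_le
  have hVm : Measurable[MeasurableSpace.comap V inferInstance] V := comap_measurable V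
  rw [condIndepFun_iff_condExp_inter_preimage_eq_mul hZ hY] at hind
  -- the conditional probabilities of `Z ∈ B` given `(V, Y)` and given `V` agree
  have hB : ∀ B, MeasurableSet B →
      P[(Z ⁻¹' B).indicator (fun _ => (1 : ℝ)) |
          MeasurableSpace.comap (fun ω => (V ω, Y ω)) inferInstance]
        =ᵐ[P] P[(Z ⁻¹' B).indicator (fun _ => (1 : ℝ)) | MeasurableSpace.comap V inferInstance] := by
    intro B hBm
    have hi : Integrable ((Z ⁻¹' B).indicator (fun _ => (1 : ℝ))) P :=
      (integrable_const 1).indicator (hZ hBm)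
    have hmVY : MeasurableSpace.comap V inferInstance ≤ MeasurableSpace.comap (fun ω => (V ω, Y ω)) inferInstance :=
      comap_le_comap_prodMk_left V Y
    refine (ae_eq_condExp_of_forall_setIntegral_eq hVY.comap_le hi
      (fun s _ _ => integrable_condExp.integrableOn) ?_
      (stronglyMeasurable_condExp.mono hmVY).aestronglyMeasurable).symm
    rintro _ ⟨s, hs, rfl⟩ -
    refine setIntegral_congr_of_rectangles hV hY integrable_condExp hi (fun S C hS hC => ?_) hs
    have hSm : MeasurableSet[MeasurableSpace.comap V inferInstance] (V ⁻¹' S) := hVm hS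
    have hiC : Integrable ((Y ⁻¹' C).indicator (fun _ => (1 : ℝ))) P :=
      (integrable_const 1).indicator (hY hC)
    have hprod : Integrable
        (P[(Z ⁻¹' B).indicator (fun _ => (1 : ℝ)) | MeasurableSpace.comap V inferInstance] *
          (Y ⁻¹' C).indicator (fun _ => (1 : ℝ))) P := by
      have : (P[(Z ⁻¹' B).indicator (fun _ => (1 : ℝ)) | MeasurableSpace.comap V inferInstance] *
          (Y ⁻¹' C).indicator (fun _ => (1 : ℝ)))
          = (Y ⁻¹' C).indicator (P[(Z ⁻¹' B).indicator (fun _ => (1 : ℝ)) | MeasurableSpace.comap V inferInstance]) := by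
        funext ω; by_cases hω : ω ∈ Y ⁻¹' C <;> simp [hω]
      rw [this]; exact integrable_condExp.indicator (hY hC)
    have hpull := condExp_mul_of_stronglyMeasurable_left (m := (MeasurableSpace.comap V inferInstance)) (μ := P)
      stronglyMeasurable_condExp hprod hiC
    calc ∫ ω in V ⁻¹' S ∩ Y ⁻¹' C, (P[(Z ⁻¹' B).indicator (fun _ => (1 : ℝ)) | MeasurableSpace.comap V inferInstance]) ω ∂P
        = ∫ ω in V ⁻¹' S, (P[(Z ⁻¹' B).indicator (fun _ => (1 : ℝ)) | MeasurableSpace.comap V inferInstance] *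
            (Y ⁻¹' C).indicator (fun _ => (1 : ℝ))) ω ∂P := by
          rw [← setIntegral_indicator (hY hC)]
          refine setIntegral_congr_fun (hV hS) fun ω _ => ?_
          by_cases hω : ω ∈ Y ⁻¹' C <;> simp [hω]
      _ = ∫ ω in V ⁻¹' S, (P[P[(Z ⁻¹' B).indicator (fun _ => (1 : ℝ)) | MeasurableSpace.comap V inferInstance] *
            (Y ⁻¹' C).indicator (fun _ => (1 : ℝ)) | MeasurableSpace.comap V inferInstance]) ω ∂P :=
          (setIntegral_condExp hle hprod hSm).symm
      _ = ∫ ω in V ⁻¹' S, (P[(Z ⁻¹' B ∩ Y ⁻¹' C).indicator (fun _ => (1 : ℝ)) | MeasurableSpace.comap V inferInstance]) ω ∂P := by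
          refine setIntegral_congr_ae (hV hS) ?_
          filter_upwards [hpull, hind B C hBm hC] with ω h1 h2 _
          rw [h1, h2]; rfl
      _ = ∫ ω in V ⁻¹' S, (Z ⁻¹' B ∩ Y ⁻¹' C).indicator (fun _ => (1 : ℝ)) ω ∂P :=
          setIntegral_condExp hle ((integrable_const 1).indicator ((hZ hBm).inter (hY hC))) hSm
      _ = ∫ ω in V ⁻¹' S ∩ Y ⁻¹' C, (Z ⁻¹' B).indicator (fun _ => (1 : ℝ)) ω ∂P := by
          rw [← setIntegral_indicator (hY hC)]
          refine setIntegral_congr_fun (hV hS) fun ω _ => ?_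
          by_cases hω : ω ∈ Y ⁻¹' C <;> by_cases hω' : ω ∈ Z ⁻¹' B <;>
            simp [Set.indicator, hω, hω']
  have hmVZ : MeasurableSpace.comap V inferInstance ≤ MeasurableSpace.comap (fun ω => (V ω, Z ω)) inferInstance :=
    comap_le_comap_prodMk_left V Z
  refine (ae_eq_condExp_of_forall_setIntegral_eq hVZ.comap_le hint
    (fun s _ _ => integrable_condExp.integrableOn) ?_
    (stronglyMeasurable_condExp.mono hmVZ).aestronglyMeasurable).symm
  rintro _ ⟨s, hs, rfl⟩ -
  refine setIntegral_congr_of_rectangles hV hZ integrable_condExp hint (fun S B hS hBm => ?_) hs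
  have hSm : MeasurableSet[MeasurableSpace.comap V inferInstance] (V ⁻¹' S) := hVm hS
  set f : Ω → ℝ := fun ω => F (V ω, Y ω) with hf
  set q : Ω → ℝ := (Z ⁻¹' B).indicator (fun _ => (1 : ℝ)) with hq
  have hiq : Integrable q P := (integrable_const 1).indicator (hZ hBm)
  -- `∫_{V ∈ S, Z ∈ B} g = ∫_{V ∈ S} g p` for every integrable `g` measurable for `σ(V, Y)`
  have main : ∀ g : Ω → ℝ, Integrable g P →
      StronglyMeasurable[MeasurableSpace.comap (fun ω => (V ω, Y ω)) inferInstance] g →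
      ∫ ω in V ⁻¹' S ∩ Z ⁻¹' B, g ω ∂P = ∫ ω in V ⁻¹' S, g ω * (P[q | MeasurableSpace.comap V inferInstance]) ω ∂P := by
    intro g hg hgm
    have hgq : Integrable (g * q) P := by
      have : g * q = (Z ⁻¹' B).indicator g := by
        funext ω; by_cases hω : ω ∈ Z ⁻¹' B <;> simp [hq, hω]
      rw [this]; exact hg.indicator (hZ hBm)
    have hSVY : MeasurableSet[MeasurableSpace.comap (fun ω => (V ω, Y ω)) inferInstance]
        (V ⁻¹' S) :=
      (measurable_fst.comp (comap_measurable fun ω => (V ω, Y ω))) hS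
    have hpull := condExp_mul_of_stronglyMeasurable_left hgm hgq hiq
    calc ∫ ω in V ⁻¹' S ∩ Z ⁻¹' B, g ω ∂P = ∫ ω in V ⁻¹' S, (g * q) ω ∂P := by
          rw [← setIntegral_indicator (hZ hBm)]
          refine setIntegral_congr_fun (hV hS) fun ω _ => ?_
          by_cases hω : ω ∈ Z ⁻¹' B <;> simp [hq, hω]
      _ = ∫ ω in V ⁻¹' S, (P[g * q |
            MeasurableSpace.comap (fun ω => (V ω, Y ω)) inferInstance]) ω ∂P :=
          (setIntegral_condExp hVY.comap_le hgq hSVY).symm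
      _ = _ := by
          refine setIntegral_congr_ae (hV hS) ?_
          filter_upwards [hpull, hB B hBm] with ω h1 h2 _
          rw [h1, Pi.mul_apply, h2]
  have hmVY : MeasurableSpace.comap V inferInstance ≤ MeasurableSpace.comap (fun ω => (V ω, Y ω)) inferInstance :=
    comap_le_comap_prodMk_left V Y
  -- With p = P(Z ∈ B | V), `main` is used both for f and for E[f | V]. It remains to compare f p
  -- and E[f | V] p on {V ∈ S}, and p pulls out of E[f p | V].
  rw [main f hint (hF.comp (comap_measurable fun ω => (V ω, Y ω))).stronglyMeasurable,
    main _ integrable_condExp (stronglyMeasurable_condExp.mono hmVY)]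
  -- Since f is only integrable, f p is integrable because p is bounded.
  have hbdd : ∀ᵐ ω ∂P, ‖(P[q | MeasurableSpace.comap V inferInstance]) ω‖ ≤ 1 := by
    have hb := ae_bdd_abs_condExp_of_ae_bdd_abs (m := (MeasurableSpace.comap V inferInstance)) (μ := P) (R := 1) (f := q)
      (Filter.Eventually.of_forall fun ω => by
        by_cases hω : ω ∈ Z ⁻¹' B <;> simp [hq, hω])
    simpa [Real.norm_eq_abs] using hb
  have hfp : Integrable (f * P[q | MeasurableSpace.comap V inferInstance]) P := by
    refine hint.mul_bdd (c := 1) integrable_condExp.aestronglyMeasurable hbdd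
  have hpull := condExp_mul_of_stronglyMeasurable_right (m := (MeasurableSpace.comap V inferInstance)) stronglyMeasurable_condExp hfp hint
  rw [← setIntegral_condExp (f := fun ω => f ω * (P[q | MeasurableSpace.comap V inferInstance]) ω) hle hfp hSm]
  refine setIntegral_congr_ae (hV hS) ?_
  filter_upwards [hpull] with ω h1 _
  exact h1.symm

theorem ProbabilityTheory.HasCondDistrib.integrable_integral [IsFiniteMeasure P] {X : Ω → 𝓧} {Y : Ω → 𝓨}
    {κ : Kernel 𝓧 𝓨} [IsMarkovKernel κ] (h : HasCondDistrib Y X κ P)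
    {f : 𝓧 × 𝓨 → ℝ} (hf : Measurable f) (hint : Integrable (fun ω => f (X ω, Y ω)) P) :
    Integrable (fun ω => ∫ y, f (X ω, y) ∂(κ (X ω))) P := by
  have h1 : Integrable f (P.map X ⊗ₘ κ) := by
    rw [← HasLaw.map_eq h, integrable_map_measure hf.aestronglyMeasurable h.aemeasurable]
    exact hint
  exact (Integrable.integral_compProd (κ := Kernel.const Unit (P.map X)) (η := κ.prodMkLeft Unit)
    (a := ()) h1).comp_aemeasurable h.aemeasurable_fst

theorem ProbabilityTheory.HasCondDistrib.ae_integrable [IsFiniteMeasure P] {X : Ω → 𝓧} {Y : Ω → 𝓨}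
    {κ : Kernel 𝓧 𝓨} [IsMarkovKernel κ] (h : HasCondDistrib Y X κ P)
    {f : 𝓧 × 𝓨 → ℝ} (hf : Measurable f) (hint : Integrable (fun ω => f (X ω, Y ω)) P) :
    ∀ᵐ ω ∂P, Integrable (fun y => f (X ω, y)) (κ (X ω)) := by
  have h1 : Integrable f (P.map X ⊗ₘ κ) := by
    rw [← HasLaw.map_eq h, integrable_map_measure hf.aestronglyMeasurable h.aemeasurable]
    exact hint
  exact ae_of_ae_map h.aemeasurable_fst ((Measure.integrable_compProd_iff h1.1).1 h1).1

/-- The conditional expectation of `f(X, Y)` given `X` when the conditional law of `Y` is known. -/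
theorem ProbabilityTheory.HasCondDistrib.condExp_comap [IsFiniteMeasure P] {X : Ω → 𝓧} {Y : Ω → 𝓨}
    (hX : Measurable X) {κ : Kernel 𝓧 𝓨} [IsMarkovKernel κ] (h : HasCondDistrib Y X κ P)
    {f : 𝓧 × 𝓨 → ℝ} (hf : Measurable f) (hint : Integrable (fun ω => f (X ω, Y ω)) P) :
    P[fun ω => f (X ω, Y ω) | MeasurableSpace.comap X inferInstance]
      =ᵐ[P] fun ω => ∫ y, f (X ω, y) ∂(κ (X ω)) := by
  have h1 : Integrable f (P.map X ⊗ₘ κ) := by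
    rw [← HasLaw.map_eq h, integrable_map_measure hf.aestronglyMeasurable h.aemeasurable]
    exact hint
  have hsm : StronglyMeasurable fun x => ∫ y, f (x, y) ∂(κ x) :=
    hf.stronglyMeasurable.integral_kernel_prod_right'
  refine (ae_eq_condExp_of_forall_setIntegral_eq hX.comap_le hint
    (fun s _ _ => (h.integrable_integral hf hint).integrableOn) ?_
    (hsm.comp_measurable (comap_measurable X)).aestronglyMeasurable).symm
  rintro _ ⟨s, hs, rfl⟩ -
  have h2 := Measure.setIntegral_compProd (μ := P.map X) (κ := κ) (s := s) hs
    (MeasurableSet.univ (α := 𝓨)) h1.integrableOn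
  rw [← HasLaw.map_eq h, setIntegral_map (hs.prod .univ) hf.aestronglyMeasurable h.aemeasurable] at h2
  simp only [Measure.restrict_univ] at h2
  rw [setIntegral_map hs hsm.aestronglyMeasurable hX.aemeasurable] at h2
  simpa [Set.mk_preimage_prod] using h2.symm

/-- If `Z` depends on `(X, Y)` only through `X`, then the conditional law of `Y` is not changed by
conditioning on `Z` in addition to `X`. -/
theorem ProbabilityTheory.HasCondDistrib.prodMk_of_comap_fst [IsFiniteMeasure P] {X : Ω → 𝓧} {Y : Ω → 𝓨}
    {Z : Ω → 𝓩} {κ : Kernel 𝓧 𝓨} [IsMarkovKernel κ] {η : Kernel 𝓧 𝓩} [IsMarkovKernel η]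
    (hX : Measurable X) (hY : Measurable Y) (hZ : Measurable Z)
    (h : HasCondDistrib Y X κ P)
    (h' : HasCondDistrib Z (fun ω => (X ω, Y ω)) (η.comap (fun x : 𝓧 × 𝓨 => x.1) (by fun_prop)) P) :
    HasCondDistrib Y (fun ω => (X ω, Z ω)) (κ.comap (fun x : 𝓧 × 𝓩 => x.1) (by fun_prop)) P := by
  have key : ∀ f : (𝓧 × 𝓩) × 𝓨 → ENNReal, Measurable f →
      ∫⁻ ω, f ((X ω, Z ω), Y ω) ∂P
        = ∫⁻ ω, ∫⁻ z, ∫⁻ y, f ((X ω, z), y) ∂(κ (X ω)) ∂(η (X ω)) ∂P := by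
    intro f hf
    have e1 : ∫⁻ ω, f ((X ω, Z ω), Y ω) ∂P
        = ∫⁻ p, f ((p.1.1, p.2), p.1.2) ∂(P.map fun ω => ((X ω, Y ω), Z ω)) := by
      rw [lintegral_map (by fun_prop) (by fun_prop)]
    rw [e1, HasLaw.map_eq h', HasLaw.map_eq h, Measure.lintegral_compProd (by fun_prop),
      Measure.lintegral_compProd, lintegral_map _ hX]
    · refine lintegral_congr fun ω => ?_
      simp only [Kernel.comap_apply]
      rw [lintegral_lintegral_swap]
      exact (by fun_prop : Measurable fun p : 𝓨 × 𝓩 => f ((X ω, p.2), p.1)).aemeasurable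
    · simp only [Kernel.comap_apply]
      refine Measurable.lintegral_kernel_prod_right' (f := fun p : 𝓧 × 𝓨 =>
        ∫⁻ z, f ((p.1, z), p.2) ∂(η p.1)) ?_
      exact Measurable.lintegral_kernel_prod_right' (κ := η.comap Prod.fst measurable_fst)
        (f := fun p : (𝓧 × 𝓨) × 𝓩 => f ((p.1.1, p.2), p.1.2)) (by fun_prop)
    · exact Measurable.lintegral_kernel_prod_right' (κ := η.comap Prod.fst measurable_fst)
        (f := fun p : (𝓧 × 𝓨) × 𝓩 => f ((p.1.1, p.2), p.1.2)) (by fun_prop)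
  refine ⟨by fun_prop, Measure.ext fun s hs => ?_⟩
  rw [Measure.map_apply (by fun_prop) hs, Measure.compProd_apply hs, lintegral_map
    (Kernel.measurable_kernel_prodMk_left hs) (by fun_prop)]
  -- The identity is used for the indicator of s and for its average over y under κ. The latter no
  -- longer depends on y, so both iterated integrals agree.
  have a1 := key (s.indicator 1) (measurable_one.indicator hs)
  have a2 := key (fun p => (κ p.1.1) (Prod.mk p.1 ⁻¹' s))
    ((Kernel.measurable_kernel_prodMk_left (κ := κ.comap Prod.fst measurable_fst) hs).comp
      measurable_fst)
  have e : ∫⁻ ω, s.indicator 1 ((X ω, Z ω), Y ω) ∂P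
      = P ((fun ω => ((X ω, Z ω), Y ω)) ⁻¹' s) := by
    rw [← lintegral_indicator_one (by measurability)]
    rfl
  rw [← e, a1]
  simp only [Kernel.comap_apply]
  rw [a2]
  refine lintegral_congr fun ω => lintegral_congr fun z => ?_
  simp only [lintegral_const, measure_univ, mul_one]
  rw [← lintegral_indicator_one (measurable_prodMk_left hs)]
  rfl

/-- Equality of the integrals over the sets `S ∩ s`, `S ∈ m`, gives equality of the conditional
expectations under the law given `s`. -/
theorem condExp_cond_congr [IsProbabilityMeasure P] {m : MeasurableSpace Ω} (hm : m ≤ mΩ)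
    {s : Set Ω} {f g : Ω → ℝ} (hf : Integrable f P) (hg : Integrable g P)
    (h : ∀ t, MeasurableSet[m] t → ∫ ω in t ∩ s, f ω ∂P = ∫ ω in t ∩ s, g ω ∂P) :
    (P[|s])[f | m] =ᵐ[P[|s]] (P[|s])[g | m] := by
  have hi : ∀ {f : Ω → ℝ}, Integrable f P → Integrable f (P[|s]) := by
    intro f hf
    -- Conditioning on a null event gives the zero measure, under which everything is integrable.
    by_cases h0 : P s = 0
    · simp [ProbabilityTheory.cond_eq_zero_of_meas_eq_zero h0]
    · exact hf.restrict.smul_measure (by simp [h0])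
  refine ae_eq_condExp_of_forall_setIntegral_eq hm (hi hg)
    (fun s _ _ => integrable_condExp.integrableOn) (fun t ht _ => ?_)
    stronglyMeasurable_condExp.aestronglyMeasurable
  rw [setIntegral_condExp hm (hi hf) ht]
  have e : ∀ f : Ω → ℝ, ∫ ω in t, f ω ∂P[|s] = (P s)⁻¹.toReal * ∫ ω in t ∩ s, f ω ∂P := by
    intro f
    rw [ProbabilityTheory.cond, Measure.restrict_smul, integral_smul_measure,
      Measure.restrict_restrict (hm _ ht), smul_eq_mul]
  rw [e, e, h t ht]

end Conditioning

/-! ### The backward value recursion and its boundedness. -/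

section Values

variable {O U A : ℕ → Type*}

/-- `(U, O, A^ν, A)` up to a time. -/
abbrev Context (O U A : ℕ → Type*) (k : ℕ) : Type _ :=
  Past U k × Past O k × Past A k × Past A k

/-- The context of a trajectory. -/
def context {k : ℕ} (h : Traj O U A k) : Context O U A k :=
  (pathU h, pathO h, pathTaken h, pathProposed h)

variable [∀ k, MeasurableSpace (O k)] [∀ k, MeasurableSpace (U k)]
  [∀ k, MeasurableSpace (A k)]

/-- Bounded measurable real functions. -/
def BoundedMeasurable {α : Type*} [MeasurableSpace α] (f : α → ℝ) : Prop :=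
  Measurable f ∧ ∃ C, ∀ x, |f x| ≤ C

theorem BoundedMeasurable.integrable {α : Type*} [MeasurableSpace α] {f : α → ℝ}
    (hf : BoundedMeasurable f) (μ : Measure α) [IsFiniteMeasure μ] : Integrable f μ := by
  obtain ⟨hm, C, hC⟩ := hf
  exact Integrable.of_bound hm.aestronglyMeasurable C (Filter.Eventually.of_forall hC)

theorem BoundedMeasurable.comp {α β : Type*} [MeasurableSpace α] [MeasurableSpace β] {f : α → ℝ}
    (hf : BoundedMeasurable f) {g : β → α} (hg : Measurable g) :
    BoundedMeasurable fun x => f (g x) :=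
  ⟨hf.1.comp hg, hf.2.imp fun _ h _ => h _⟩

theorem BoundedMeasurable.add {α : Type*} [MeasurableSpace α] {f g : α → ℝ}
    (hf : BoundedMeasurable f) (hg : BoundedMeasurable g) :
    BoundedMeasurable fun x => f x + g x := by
  obtain ⟨hf, C, hC⟩ := hf
  obtain ⟨hg, D, hD⟩ := hg
  exact ⟨hf.add hg, C + D, fun x => (abs_add_le _ _).trans (add_le_add (hC x) (hD x))⟩

theorem BoundedMeasurable.mul {α : Type*} [MeasurableSpace α] {f g : α → ℝ}
    (hf : BoundedMeasurable f) (hg : BoundedMeasurable g) :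
    BoundedMeasurable fun x => f x * g x := by
  obtain ⟨hf, C, hC⟩ := hf
  obtain ⟨hg, D, hD⟩ := hg
  refine ⟨hf.mul hg, C * D, fun x => ?_⟩
  rw [abs_mul]
  exact mul_le_mul (hC x) (hD x) (abs_nonneg _) ((abs_nonneg _).trans (hC x))

theorem BoundedMeasurable.sum {α ι : Type*} [MeasurableSpace α] {s : Finset ι} {f : ι → α → ℝ}
    (hf : ∀ i ∈ s, BoundedMeasurable (f i)) : BoundedMeasurable fun x => ∑ i ∈ s, f i x := by
  classical
  induction s using Finset.induction_on with
  | empty => exact ⟨by simp, 0, by simp⟩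
  | insert i s hi ih =>
    simp only [Finset.sum_insert hi]
    exact (hf i (by simp)).add (ih fun j hj => hf j (by simp [hj]))

theorem BoundedMeasurable.integral_kernel {α β : Type*} [MeasurableSpace α] [MeasurableSpace β]
    {f : α × β → ℝ} (hf : BoundedMeasurable f) (κ : Kernel α β) [IsMarkovKernel κ] :
    BoundedMeasurable fun x => ∫ y, f (x, y) ∂(κ x) := by
  obtain ⟨hm, C, hC⟩ := hf
  refine ⟨hm.stronglyMeasurable.integral_kernel_prod_right'.measurable, C, fun x => ?_⟩
  have := norm_integral_le_of_norm_le_const (μ := κ x) (f := fun y => f (x, y))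
    (Filter.Eventually.of_forall fun y => hC (x, y))
  simpa using this

theorem boundedMeasurable_kernel_real {α β : Type*} [MeasurableSpace α] [MeasurableSpace β]
    (κ : Kernel α β) [IsMarkovKernel κ] {s : Set β} (hs : MeasurableSet s) :
    BoundedMeasurable fun x => (κ x).real s :=
  ⟨(κ.measurable_coe hs).ennreal_toReal, 1, fun x => by
    rw [abs_of_nonneg measureReal_nonneg]; exact measureReal_le_one⟩

variable (M : ConfoundedProcess O U A) (ν : SuperPolicy O A)

/-- Mean reward given the features and the actions taken. -/
def rewardMean (k : ℕ) (z : Past U (k + 1) × Past O (k + 1) × Past A (k + 1)) : ℝ :=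
  ∫ r, r ∂(M.reward k z)

@[fun_prop]
theorem measurable_context {k : ℕ} : Measurable (context : Traj O U A k → _) := by
  unfold context; fun_prop

/-- The mean of `ν_k(a | ·)` times the reward plus the continuation value `c`, when the
observation at time `k` is emitted and the action `a` is taken. -/
def actionValue (k : ℕ) (c : Context O U A (k + 1) → ℝ) (a : A k)
    (z : Past U (k + 1) × Past O k × Past A k × Past A (k + 1)) : ℝ :=
  ∫ x, ν.prob k a (Past.snoc z.2.1 x) z.2.2.1 z.2.2.2 *
    (rewardMean M k (z.1, Past.snoc z.2.1 x, Past.snoc z.2.2.1 a) +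
      c (z.1, Past.snoc z.2.1 x, Past.snoc z.2.2.1 a, z.2.2.2)) ∂(M.emission k z.1)

/-- The mean of `∑_{a'} q(a', ·)` when the latent feature is drawn and the behavior policy
proposes an action. -/
def proposalValue [∀ k, Fintype (A k)] (k : ℕ)
    (q : A k → Past U (k + 1) × Past O k × Past A k × Past A (k + 1) → ℝ)
    (z : Context O U A k) : ℝ :=
  ∫ u, ∑ p, (M.behavior k (Past.snoc z.1 u, z.2.2.1)).real {p} *
    ∑ a, q a (Past.snoc z.1 u, z.2.1, z.2.2.1, Past.snoc z.2.2.2 p)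
      ∂(M.latent k (z.1, z.2.1, z.2.2.1))

/-- The expected sum of the next `n` rewards when `ν` acts. -/
def contValue [∀ k, Fintype (A k)] : (n k : ℕ) → Context O U A k → ℝ
  | 0, _ => fun _ => 0
  | n + 1, k => proposalValue M k fun a => actionValue M ν k (contValue n (k + 1)) a

/-- Rewards are bounded only almost surely under the reward kernel, but their means are bounded at
every point. The recursion therefore stays within bounded functions and needs no exceptional sets.
-/
theorem boundedMeasurable_rewardMean (k : ℕ) : BoundedMeasurable (rewardMean M k) := by
  refine ⟨(measurable_snd.stronglyMeasurable.integral_kernel_prod_right'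
    (f := Prod.snd)).measurable, M.rewardBound, fun x => ?_⟩
  have := norm_integral_le_of_norm_le_const (f := fun r : ℝ => r) (M.reward_le k x)
  simpa [rewardMean] using this

variable [∀ k, MeasurableSingletonClass (A k)]

theorem boundedMeasurable_prob (k : ℕ) (a : A k) :
    BoundedMeasurable fun z : Past O (k + 1) × Past A k × Past A (k + 1) =>
      ν.prob k a z.1 z.2.1 z.2.2 :=
  boundedMeasurable_kernel_real (ν.kernel k) (measurableSet_singleton a)

theorem boundedMeasurable_actionValue_integrand (k : ℕ) {c : Context O U A (k + 1) → ℝ}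
    (hc : BoundedMeasurable c) (a : A k) :
    BoundedMeasurable fun y : (Past U (k + 1) × Past O k × Past A k × Past A (k + 1)) × O k =>
      ν.prob k a (Past.snoc y.1.2.1 y.2) y.1.2.2.1 y.1.2.2.2 *
      (rewardMean M k (y.1.1, Past.snoc y.1.2.1 y.2, Past.snoc y.1.2.2.1 a) +
      c (y.1.1, Past.snoc y.1.2.1 y.2, Past.snoc y.1.2.2.1 a, y.1.2.2.2)) := by
  refine BoundedMeasurable.mul ?_ (BoundedMeasurable.add ?_ ?_)
  · exact (boundedMeasurable_prob ν k a).comp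
      (g := fun y : (Past U (k + 1) × Past O k × Past A k × Past A (k + 1)) × O k =>
        (Past.snoc y.1.2.1 y.2, y.1.2.2.1, y.1.2.2.2)) (by fun_prop)
  · exact (boundedMeasurable_rewardMean M k).comp (by fun_prop)
  · exact hc.comp (by fun_prop)

theorem boundedMeasurable_actionValue (k : ℕ) {c : Context O U A (k + 1) → ℝ}
    (hc : BoundedMeasurable c) (a : A k) : BoundedMeasurable (actionValue M ν k c a) :=
  (boundedMeasurable_actionValue_integrand M ν k hc a).integral_kernel
    ((M.emission k).comap (fun z => z.1) (by fun_prop))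

variable [∀ k, Fintype (A k)]

theorem boundedMeasurable_proposalValue_integrand (k : ℕ)
    {q : A k → Past U (k + 1) × Past O k × Past A k × Past A (k + 1) → ℝ}
    (hq : ∀ a, BoundedMeasurable (q a)) :
    BoundedMeasurable fun y : Context O U A k × U k =>
      ∑ p, (M.behavior k (Past.snoc y.1.1 y.2, y.1.2.2.1)).real {p} *
        ∑ a, q a (Past.snoc y.1.1 y.2, y.1.2.1, y.1.2.2.1, Past.snoc y.1.2.2.2 p) := by
  refine BoundedMeasurable.sum fun p _ => BoundedMeasurable.mul ?_
    (BoundedMeasurable.sum fun a _ => ?_)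
  · exact (boundedMeasurable_kernel_real (M.behavior k) (measurableSet_singleton p)).comp
      (by fun_prop)
  · exact (hq a).comp (by fun_prop)

theorem boundedMeasurable_proposalValue (k : ℕ)
    {q : A k → Past U (k + 1) × Past O k × Past A k × Past A (k + 1) → ℝ}
    (hq : ∀ a, BoundedMeasurable (q a)) : BoundedMeasurable (proposalValue M k q) :=
  (boundedMeasurable_proposalValue_integrand M k hq).integral_kernel
    ((M.latent k).comap (fun z => (z.1, z.2.1, z.2.2.1)) (by fun_prop))

theorem boundedMeasurable_contValue (n k : ℕ) : BoundedMeasurable (contValue M ν n k) := by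
  induction n generalizing k with
  | zero => exact ⟨measurable_const, 0, fun _ => by simp [contValue]⟩
  | succ n ih =>
    exact boundedMeasurable_proposalValue M k fun a =>
      boundedMeasurable_actionValue M ν k (ih (k + 1)) a

end Values

/-! ### One step of the process under a super-policy. -/

section Paths

variable {O U A : ℕ → Type*}

@[simp]
theorem Past.snoc_castSucc {X : ℕ → Type*} {k : ℕ} (p : Past X k) (x : X k) (i : Fin k) :
    Past.snoc p x i.castSucc = p i := by simp [Past.snoc]

@[simp]
theorem Past.snoc_last {X : ℕ → Type*} {k : ℕ} (p : Past X k) (x : X k) :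
    Past.snoc p x (Fin.last k) = x := by simp [Past.snoc]

theorem Past.ext_snoc {X : ℕ → Type*} {k : ℕ} {p q : Past X (k + 1)}
    (h : ∀ i : Fin k, p i.castSucc = q i.castSucc) (h' : p (Fin.last k) = q (Fin.last k)) :
    p = q := by
  funext i
  exact Fin.lastCases h' h i

theorem context_snoc {k : ℕ} (h : Traj O U A k) (s : Step O U A k) :
    context (Past.snoc h s : Traj O U A (k + 1)) =
      (Past.snoc (pathU h) s.1.1.1.1, Past.snoc (pathO h) s.1.1.1.2,
        Past.snoc (pathTaken h) s.1.2, Past.snoc (pathProposed h) s.1.1.2) := by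
  unfold context
  refine Prod.ext ?_ (Prod.ext ?_ (Prod.ext ?_ ?_)) <;>
    exact Past.ext_snoc (by simp [pathU, pathO, pathTaken, pathProposed])
      (by simp [pathU, pathO, pathTaken, pathProposed])

theorem pastOf_succ {Ω : Type*} {X : ℕ → Type*} (V : ∀ k, Ω → X k) (k : ℕ) (ω : Ω) :
    pastOf V (k + 1) ω = Past.snoc (pastOf V k ω) (V k ω) :=
  Past.ext_snoc (by simp [pastOf]) (by simp [pastOf])

variable [∀ k, MeasurableSpace (O k)] [∀ k, MeasurableSpace (U k)]
  [∀ k, MeasurableSpace (A k)]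
variable (M : ConfoundedProcess O U A) (ν : SuperPolicy O A)

instance instIsMarkovKernelStepLaw (k : ℕ) : IsMarkovKernel (stepLaw M ν k) := by
  unfold stepLaw; infer_instance

instance instIsMarkovKernelPathLaw (k n : ℕ) : IsMarkovKernel (pathLaw M ν k n) := by
  induction n with
  | zero => unfold pathLaw; infer_instance
  | succ n ih =>
    unfold pathLaw
    have : IsMarkovKernel ((Kernel.id ×ₖ stepLaw M ν (k + n)).map fun q =>
      (Past.snoc q.1 q.2 : Traj O U A (k + n + 1))) :=
      Kernel.IsMarkovKernel.map _ measurable_snoc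
    infer_instance

theorem ae_stepLaw_reward_le (k : ℕ) (h : Traj O U A k) :
    ∀ᵐ s ∂(stepLaw M ν k h), |s.2| ≤ M.rewardBound := by
  unfold stepLaw
  refine Kernel.ae_compProd_of_ae_ae (p := fun s : Step O U A k => |s.2| ≤ M.rewardBound)
    (measurableSet_le (by fun_prop) (by fun_prop)) (Filter.Eventually.of_forall fun b => ?_)
  exact M.reward_le _ _

/-- Fubini along the five kernels that make up a step, innermost first: reward, taken action,
proposal, observation, latent feature. Integrals over actions become finite sums. -/
theorem integral_stepLaw [∀ k, MeasurableSingletonClass (A k)] [∀ k, Fintype (A k)] (k : ℕ)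
    {c : Context O U A (k + 1) → ℝ} (hc : BoundedMeasurable c) (h : Traj O U A k) :
    ∫ s, (s.2 + c (context (Past.snoc h s : Traj O U A (k + 1)))) ∂(stepLaw M ν k h)
      = proposalValue M k (fun a => actionValue M ν k c a) (context h) := by
  simp only [context_snoc]
  have hcc : BoundedMeasurable fun s : Step O U A k =>
      c (Past.snoc (pathU h) s.1.1.1.1, Past.snoc (pathO h) s.1.1.1.2,
        Past.snoc (pathTaken h) s.1.2, Past.snoc (pathProposed h) s.1.1.2) :=
    hc.comp (by fun_prop)
  have hr : Integrable (fun s : Step O U A k => s.2) (stepLaw M ν k h) :=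
    Integrable.of_bound measurable_snd.aestronglyMeasurable M.rewardBound
      (ae_stepLaw_reward_le M ν k h)
  have h0 : Integrable (fun s : Step O U A k => s.2 +
      c (Past.snoc (pathU h) s.1.1.1.1, Past.snoc (pathO h) s.1.1.1.2,
        Past.snoc (pathTaken h) s.1.2, Past.snoc (pathProposed h) s.1.1.2)) (stepLaw M ν k h) :=
    hr.add (hcc.integrable (stepLaw M ν k h))
  -- the integrand after the reward has been integrated out
  let G : ((U k × O k) × A k) × A k → ℝ := fun s =>
    rewardMean M k (Past.snoc (pathU h) s.1.1.1, Past.snoc (pathO h) s.1.1.2,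
      Past.snoc (pathTaken h) s.2) +
    c (Past.snoc (pathU h) s.1.1.1, Past.snoc (pathO h) s.1.1.2,
        Past.snoc (pathTaken h) s.2, Past.snoc (pathProposed h) s.1.2)
  have hG : BoundedMeasurable G := by
    refine BoundedMeasurable.add ?_ ?_
    · exact (boundedMeasurable_rewardMean M k).comp (by fun_prop)
    · exact hc.comp (by fun_prop)
  unfold stepLaw at h0 ⊢
  have hrew : ∀ s : ((U k × O k) × A k) × A k, Integrable (fun r : ℝ => r)
      (M.reward k (Past.snoc (pathU h) s.1.1.1, Past.snoc (pathO h) s.1.1.2,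
        Past.snoc (pathTaken h) s.2)) := fun s =>
    Integrable.of_bound measurable_id.aestronglyMeasurable M.rewardBound (M.reward_le _ _)
  rw [integral_compProd h0]
  have e1 : ∀ s : ((U k × O k) × A k) × A k,
      ∫ r, (r + c (Past.snoc (pathU h) s.1.1.1, Past.snoc (pathO h) s.1.1.2,
        Past.snoc (pathTaken h) s.2, Past.snoc (pathProposed h) s.1.2))
        ∂(M.reward k (Past.snoc (pathU h) s.1.1.1, Past.snoc (pathO h) s.1.1.2,
        Past.snoc (pathTaken h) s.2)) = G s := by
    intro s
    rw [integral_add (hrew s) (integrable_const _)]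
    simp [G, rewardMean]
  simp only [Kernel.comap_apply]
  rw [integral_congr_ae (Filter.Eventually.of_forall e1)]
  rw [integral_compProd (hG.integrable _)]
  simp only [Kernel.comap_apply]
  have hG3 : BoundedMeasurable fun s : (U k × O k) × A k =>
      ∑ a, ν.prob k a (Past.snoc (pathO h) s.1.2) (pathTaken h)
        (Past.snoc (pathProposed h) s.2) * G (s, a) := by
    refine BoundedMeasurable.sum fun a _ => BoundedMeasurable.mul ?_ ?_
    · exact (boundedMeasurable_prob ν k a).comp (g := fun s : (U k × O k) × A k =>
        (Past.snoc (pathO h) s.1.2, pathTaken h, Past.snoc (pathProposed h) s.2)) (by fun_prop)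
    · exact hG.comp (by fun_prop)
  have e2 : ∀ s : (U k × O k) × A k, ∫ a, G (s, a) ∂(ν.kernel k (Past.snoc (pathO h) s.1.2,
      pathTaken h, Past.snoc (pathProposed h) s.2)) =
      ∑ a, ν.prob k a (Past.snoc (pathO h) s.1.2) (pathTaken h)
        (Past.snoc (pathProposed h) s.2) * G (s, a) := by
    intro s
    rw [integral_fintype ((hG.comp (by fun_prop)).integrable _)]
    rfl
  rw [integral_congr_ae (Filter.Eventually.of_forall e2), integral_compProd (hG3.integrable _)]
  simp only [Kernel.comap_apply]
  have hG2 : BoundedMeasurable fun s : U k × O k =>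
      ∑ p, (M.behavior k (Past.snoc (pathU h) s.1, pathTaken h)).real {p} *
        ∑ a, ν.prob k a (Past.snoc (pathO h) s.2) (pathTaken h)
        (Past.snoc (pathProposed h) p) * G ((s, p), a) := by
    refine BoundedMeasurable.sum fun p _ => BoundedMeasurable.mul ?_ ?_
    · exact (boundedMeasurable_kernel_real (M.behavior k) (measurableSet_singleton p)).comp
        (by fun_prop)
    · exact hG3.comp (g := fun s : U k × O k => (s, p)) (by fun_prop)
  have e3 : ∀ s : U k × O k, ∫ p, ∑ a, ν.prob k a (Past.snoc (pathO h) s.2) (pathTaken h)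
        (Past.snoc (pathProposed h) p) * G ((s, p), a)
        ∂(M.behavior k (Past.snoc (pathU h) s.1, pathTaken h)) =
      ∑ p, (M.behavior k (Past.snoc (pathU h) s.1, pathTaken h)).real {p} *
        ∑ a, ν.prob k a (Past.snoc (pathO h) s.2) (pathTaken h)
        (Past.snoc (pathProposed h) p) * G ((s, p), a) := by
    intro s
    rw [integral_fintype ((hG3.comp (g := fun p : A k => (s, p)) (by fun_prop)).integrable _)]
    rfl
  rw [integral_congr_ae (Filter.Eventually.of_forall e3), integral_compProd (hG2.integrable _)]
  simp only [Kernel.comap_apply]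
  unfold proposalValue
  refine integral_congr_ae (Filter.Eventually.of_forall fun u => ?_)
  have hint : ∀ p a, Integrable (fun x : O k => ν.prob k a (Past.snoc (pathO h) x) (pathTaken h)
        (Past.snoc (pathProposed h) p) * G (((u, x), p), a))
        (M.emission k (Past.snoc (pathU h) u)) := by
    intro p a
    refine BoundedMeasurable.integrable (BoundedMeasurable.mul ?_ ?_) _
    · exact (boundedMeasurable_prob ν k a).comp (g := fun x : O k =>
        (Past.snoc (pathO h) x, pathTaken h, Past.snoc (pathProposed h) p)) (by fun_prop)
    · exact hG.comp (by fun_prop)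
  dsimp only
  rw [integral_finsetSum _ fun p _ => (integrable_finsetSum _ fun a _ => hint p a).const_mul _]
  refine Finset.sum_congr rfl fun p _ => ?_
  rw [integral_const_mul, integral_finsetSum _ fun a _ => hint p a]
  rfl

end Paths

/-! ### Expected returns along the path law. -/

section PathLaw

variable {O U A : ℕ → Type*}

theorem returnFrom_snoc {k n : ℕ} (hkn : k ≤ n) (h : Traj O U A n) (s : Step O U A n) :
    returnFrom k (Past.snoc h s : Traj O U A (n + 1)) = returnFrom k h + s.2 := by
  unfold returnFrom pathReward
  rw [Fin.sum_univ_castSucc]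
  simp [hkn]

theorem returnFrom_self {k : ℕ} (h : Traj O U A k) : returnFrom k h = 0 := by
  unfold returnFrom
  exact Finset.sum_eq_zero fun i _ => by simp

theorem returnFrom_eq_add {k n : ℕ} (hkn : k < n) (h : Traj O U A n) :
    returnFrom k h = (h ⟨k, hkn⟩).2 + returnFrom (k + 1) h := by
  unfold returnFrom
  have : ∀ i : Fin n, (if k ≤ (i : ℕ) then pathReward h i else 0) =
      (if i = ⟨k, hkn⟩ then pathReward h i else 0) +
        if k + 1 ≤ (i : ℕ) then pathReward h i else 0 := by
    intro i
    rcases lt_trichotomy (i : ℕ) k with hi | hi | hi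
    · simp [Fin.ext_iff, hi.ne, hi.not_ge, show ¬ k + 1 ≤ (i : ℕ) by omega]
    · simp [Fin.ext_iff, hi]
    · simp [Fin.ext_iff, hi.ne', hi.le, show k + 1 ≤ (i : ℕ) by omega]
  rw [Finset.sum_congr rfl fun i _ => this i, Finset.sum_add_distrib]
  simp [pathReward]

variable [∀ k, MeasurableSpace (O k)] [∀ k, MeasurableSpace (U k)]
  [∀ k, MeasurableSpace (A k)]

theorem measurable_returnFrom {k n : ℕ} : Measurable (returnFrom k : Traj O U A n → ℝ) := by
  unfold returnFrom pathReward
  refine Finset.measurable_sum _ fun i _ => ?_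
  split_ifs
  · fun_prop
  · exact measurable_const

/-- The starting trajectory of `lawSetting`. -/
def settingTraj (k : ℕ) (u : Past U (k + 1)) (o : Past O (k + 1)) (taken : Past A (k + 1))
    (prop : Past A (k + 1)) (r : ℝ) : Traj O U A (k + 1) :=
  fun i => ((((u i, o i), prop i), taken i), if (i : ℕ) = k then r else 0)

theorem measurable_settingTraj (k : ℕ) (u : Past U (k + 1)) (o : Past O k)
    (taken : Past A (k + 1)) (prop : Past A (k + 1)) :
    Measurable fun y : O k × ℝ => settingTraj k u (Past.snoc o y.1) taken prop y.2 := by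
  have h : Measurable fun y : O k × ℝ => Past.snoc o y.1 := by fun_prop
  refine measurable_pi_iff.2 fun i => ?_
  unfold settingTraj
  have h' : Measurable fun y : O k × ℝ => Past.snoc o y.1 i := (measurable_pi_apply i).comp h
  refine Measurable.prodMk (by fun_prop) ?_
  split_ifs
  · fun_prop
  · exact measurable_const

variable (M : ConfoundedProcess O U A) (ν : SuperPolicy O A)

theorem pathLaw_zero_apply (k : ℕ) (h : Traj O U A k) :
    pathLaw M ν k 0 h = Measure.dirac h := by
  simp [pathLaw, Kernel.id_apply]

theorem extend_apply (k : ℕ) (h : Traj O U A k) :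
    ((Kernel.id ×ₖ stepLaw M ν k).map
      fun q => (Past.snoc q.1 q.2 : Traj O U A (k + 1))) h =
    (stepLaw M ν k h).map fun s => (Past.snoc h s : Traj O U A (k + 1)) := by
  rw [Kernel.map_apply _ (measurable_snoc (X := Step O U A)), Kernel.prod_apply, Kernel.id_apply, Measure.dirac_prod,
    Measure.map_map measurable_snoc measurable_prodMk_left]
  rfl

/-- The induction step for almost sure properties when one more step is appended to a path. -/
theorem ae_pathLaw_succ {k n : ℕ} {h₀ : Traj O U A k} {p : Traj O U A (k + n + 1) → Prop}
    (hp : MeasurableSet {h | p h})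
    (H : ∀ᵐ h ∂(pathLaw M ν k n h₀), ∀ᵐ s ∂(stepLaw M ν (k + n) h), p (Past.snoc h s)) :
    ∀ᵐ h ∂(pathLaw M ν k (n + 1) h₀), p h := by
  refine Kernel.ae_comp_of_ae_ae hp ?_
  filter_upwards [H] with h hh
  rw [extend_apply]
  exact (ae_map_iff (by fun_prop) hp).2 hh

theorem integral_pathLaw_succ {k n : ℕ} {h₀ : Traj O U A k} {f : Traj O U A (k + n + 1) → ℝ}
    (hf : Measurable f) (hint : Integrable f (pathLaw M ν k (n + 1) h₀)) :
    ∫ h, f h ∂(pathLaw M ν k (n + 1) h₀) =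
      ∫ h, ∫ s, f (Past.snoc h s) ∂(stepLaw M ν (k + n) h) ∂(pathLaw M ν k n h₀) := by
  have h1 := Kernel.integral_comp (κ := pathLaw M ν k n) (a := h₀)
    (η := (Kernel.id ×ₖ stepLaw M ν (k + n)).map fun q =>
      (Past.snoc q.1 q.2 : Traj O U A (k + n + 1))) hint
  refine h1.trans (integral_congr_ae (Filter.Eventually.of_forall fun h => ?_))
  dsimp only
  rw [extend_apply, integral_map (by fun_prop) hf.aestronglyMeasurable]

/-- The steps that are already there are kept. -/
theorem ae_pathLaw_eq (k n : ℕ) (h₀ : Traj O U A k) (i : ℕ) (hi : i < k)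
    {f : Step O U A i → ℝ} (hf : Measurable f) :
    ∀ᵐ h ∂(pathLaw M ν k n h₀), f (h ⟨i, by omega⟩) = f (h₀ ⟨i, hi⟩) := by
  induction n with
  | zero =>
    rw [pathLaw_zero_apply]
    refine (ae_dirac_iff ?_).2 rfl
    exact measurableSet_eq_fun (hf.comp (measurable_pi_apply (⟨i, hi⟩ : Fin k))) measurable_const
  | succ n ih =>
    refine ae_pathLaw_succ M ν (p := fun h => f (h ⟨i, by omega⟩) = f (h₀ ⟨i, hi⟩)) ?_ ?_
    · exact measurableSet_eq_fun
        (hf.comp (measurable_pi_apply (⟨i, by omega⟩ : Fin (k + n + 1)))) measurable_const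
    · filter_upwards [ih] with h hh
      refine Filter.Eventually.of_forall fun s => ?_
      rw [← hh]
      exact congrArg f (Past.snoc_castSucc h s ⟨i, by omega⟩)

/-- The return is counted from time k, so the rewards stored in `h₀`, which are arbitrary reals, do
not enter. -/
theorem ae_pathLaw_returnFrom_le (k n : ℕ) (h₀ : Traj O U A k) :
    ∀ᵐ h ∂(pathLaw M ν k n h₀), |returnFrom k h| ≤ n * M.rewardBound := by
  induction n with
  | zero =>
    rw [pathLaw_zero_apply]
    refine (ae_dirac_iff ?_).2 ?_
    · exact measurableSet_le (measurable_returnFrom (k := k) (n := k)).abs measurable_const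
    · have := returnFrom_self h₀
      simp only [Nat.cast_zero, zero_mul]
      exact (abs_eq_zero.2 this).le
  | succ n ih =>
    refine ae_pathLaw_succ M ν ?_ ?_
    · exact measurableSet_le measurable_returnFrom.abs measurable_const
    · filter_upwards [ih] with h hh
      filter_upwards [ae_stepLaw_reward_le M ν (k + n) h] with s hs
      rw [returnFrom_snoc (Nat.le_add_right k n)]
      push_cast
      calc |returnFrom k h + s.2| ≤ |returnFrom k h| + |s.2| := abs_add_le _ _
        _ ≤ _ := by linarith

theorem integrable_returnFrom (k n : ℕ) (h₀ : Traj O U A k) :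
    Integrable (returnFrom k) (pathLaw M ν k n h₀) :=
  Integrable.of_bound measurable_returnFrom.aestronglyMeasurable _
    (ae_pathLaw_returnFrom_le M ν k n h₀)

variable [∀ k, MeasurableSingletonClass (A k)] [∀ k, Fintype (A k)]

/-- `pathLaw` grows by appending a last step, whereas `contValue` unfolds its first step. The
remainder `m` reconciles the two: integrating out the last appended step turns the continuation
value over `m` steps into the one over `m + 1`, so the induction must hold for all `m`. -/
theorem integral_pathLaw_add (k n m : ℕ) (h₀ : Traj O U A k) :
    ∫ h, (returnFrom k h + contValue M ν m (k + n) (context h)) ∂(pathLaw M ν k n h₀) =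
      contValue M ν (n + m) k (context h₀) := by
  induction n generalizing m with
  | zero =>
    rw [pathLaw_zero_apply]
    refine (integral_dirac' (fun h : Traj O U A k =>
      returnFrom k h + contValue M ν m k (context h)) h₀ ?_).trans ?_
    rotate_left
    · rw [returnFrom_self, zero_add, zero_add]
    · exact (measurable_returnFrom.add ((boundedMeasurable_contValue M ν m k).1.comp
        measurable_context)).stronglyMeasurable
  | succ n ih =>
    have hc := (boundedMeasurable_contValue M ν m (k + n + 1))
    have hcc := hc.comp (measurable_context (O := O) (U := U) (A := A))
    refine (integral_pathLaw_succ M ν (f := fun h =>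
      returnFrom k h + contValue M ν m (k + n + 1) (context h))
      (measurable_returnFrom.add hcc.1)
      ((integrable_returnFrom M ν k (n + 1) h₀).add (hcc.integrable _))).trans ?_
    rw [show n + 1 + m = n + (m + 1) by omega, ← ih (m + 1)]
    refine integral_congr_ae (Filter.Eventually.of_forall fun h => ?_)
    dsimp only
    simp only [returnFrom_snoc (Nat.le_add_right k n), add_assoc]
    have hi : Integrable (fun s : Step O U A (k + n) => s.2 + contValue M ν m (k + n + 1)
        (context (Past.snoc h s : Traj O U A (k + n + 1)))) (stepLaw M ν (k + n) h) := by
      refine Integrable.add ?_ ((hcc.comp (by fun_prop)).integrable _)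
      exact Integrable.of_bound measurable_snd.aestronglyMeasurable M.rewardBound
        (ae_stepLaw_reward_le M ν (k + n) h)
    have := integral_stepLaw M ν (k + n) hc h
    refine (integral_add (integrable_const _) hi).trans ?_
    rw [this]
    simp [contValue]

theorem integral_pathLaw (k n : ℕ) (h₀ : Traj O U A k) :
    ∫ h, returnFrom k h ∂(pathLaw M ν k n h₀) = contValue M ν n k (context h₀) := by
  have := integral_pathLaw_add M ν k n 0 h₀
  simpa [contValue] using this

theorem value_eq (T : ℕ) :
    value M T ν = contValue M ν T 0
      (fun i => i.elim0, fun i => i.elim0, fun i => i.elim0, fun i => i.elim0) := by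
  unfold value
  have h1 := integral_pathLaw_add M ν 0 T 0 (fun i => i.elim0)
  simp only [contValue, add_zero] at h1
  have h2 : context (fun i : Fin 0 => (i.elim0 : Step O U A i)) =
      ((fun i => i.elim0, fun i => i.elim0, fun i => i.elim0, fun i => i.elim0) :
        Context O U A 0) := by
    refine Prod.ext ?_ (Prod.ext ?_ (Prod.ext ?_ ?_)) <;> exact funext fun i => i.elim0
  rw [← h2]
  exact h1

/-- Once O_k and the reward R_k are fixed, the weight is a constant and the later return has mean
`contValue`. Averaging over R_k and then O_k leaves `actionValue`. -/
theorem weightedReturn_eq (T k : ℕ) (u : Past U (k + 1)) (o : Past O k)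
    (taken : Past A k) (prop : Past A (k + 1)) (a : A k) :
    weightedReturn M T ν k u o taken prop a =
      actionValue M ν k (contValue M ν (T - (k + 1)) (k + 1)) a (u, o, taken, prop) := by
  set n := T - (k + 1) with hn
  let K : Kernel (O k × ℝ) (Traj O U A (k + 1 + n)) :=
    (pathLaw M ν (k + 1) n).comap _
      (measurable_settingTraj k u o (Past.snoc taken a) prop)
  let R : Kernel (O k) ℝ := (M.reward k).comap
    (fun x => (u, Past.snoc o x, Past.snoc taken a)) (by fun_prop)
  let E := M.emission k u
  let g : O k → ℝ := fun x => ν.prob k a (Past.snoc o x) taken prop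
  have hg : BoundedMeasurable g := (boundedMeasurable_prob ν k a).comp
    (g := fun x : O k => (Past.snoc o x, taken, prop)) (by fun_prop)
  let f : Traj O U A (k + 1 + n) → ℝ := fun h =>
    returnFrom k h * ν.prob k a (Past.snoc o (h ⟨k, by omega⟩).1.1.1.2) taken prop
  have hcoord : Measurable fun h : Traj O U A (k + 1 + n) => (h ⟨k, by omega⟩).1.1.1.2 :=
    (by fun_prop : Measurable fun s : Step O U A k => s.1.1.1.2).comp
      (measurable_pi_apply (⟨k, by omega⟩ : Fin (k + 1 + n)))
  have hf : Measurable f := measurable_returnFrom.mul (hg.1.comp hcoord)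
  -- The nested `bind` becomes a composition of kernels, to which integrability and Fubini
  -- statements apply.
  have hlaw : lawSetting M T ν k u o taken prop a = (R ⊗ₖ K).snd ∘ₘ E := by
    unfold lawSetting
    refine Measure.bind_congr_right (Filter.Eventually.of_forall fun x => ?_)
    ext s hs
    rw [Kernel.snd_apply' _ _ hs, Kernel.compProd_apply (measurable_snd hs)]
    have hK : Measurable fun r : ℝ => K (x, r) := K.measurable.comp measurable_prodMk_left
    exact Measure.bind_apply hs hK.aemeasurable
  -- the integrand under the law of the continuation
  have hae : ∀ x r, f =ᵐ[K (x, r)] fun h => (r + returnFrom (k + 1) h) * g x := by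
    intro x r
    have h1 := ae_pathLaw_eq M ν (k + 1) n (settingTraj k u (Past.snoc o x) (Past.snoc taken a)
      prop r) k (by omega) (f := fun s => s.2) measurable_snd
    have h2 := ae_pathLaw_eq M ν (k + 1) n (settingTraj k u (Past.snoc o x) (Past.snoc taken a)
      prop r) k (by omega) (f := fun s => g s.1.1.1.2) (hg.1.comp (by fun_prop))
    filter_upwards [h1, h2] with h h1 h2
    have h3 : returnFrom k h = r + returnFrom (k + 1) h := by
      rw [returnFrom_eq_add (by omega), h1]
      simp [settingTraj]
    have h4 : g (h ⟨k, by omega⟩).1.1.1.2 = g x := by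
      rw [h2]
      exact congrArg g (Past.snoc_last o x)
    exact congrArg₂ (· * ·) h3 h4
  have hbound : ∀ᵐ h ∂((R ⊗ₖ K).snd ∘ₘ E),
      |f h| ≤ (M.rewardBound + n * M.rewardBound) := by
    have hms : MeasurableSet {h | |f h| ≤ (M.rewardBound + n * M.rewardBound)} :=
      measurableSet_le hf.abs measurable_const
    refine Measure.ae_comp_of_ae_ae hms (Filter.Eventually.of_forall fun x => ?_)
    rw [Kernel.snd_apply, ae_map_iff measurable_snd.aemeasurable hms]
    refine Kernel.ae_compProd_of_ae_ae (measurable_snd hms) ?_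
    filter_upwards [M.reward_le k (u, Past.snoc o x, Past.snoc taken a)] with r hr
    filter_upwards [hae x r, ae_pathLaw_returnFrom_le M ν (k + 1) n
      (settingTraj k u (Past.snoc o x) (Past.snoc taken a) prop r)] with h h1 h2
    rw [h1, abs_mul]
    have hg1 : |g x| ≤ 1 := by
      simp only [g, SuperPolicy.prob]
      rw [abs_of_nonneg measureReal_nonneg]; exact measureReal_le_one
    calc |r + returnFrom (k + 1) h| * |g x| ≤ |r + returnFrom (k + 1) h| * 1 := by gcongr
      _ ≤ |r| + |returnFrom (k + 1) h| := by rw [mul_one]; exact abs_add_le _ _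
      _ ≤ _ := add_le_add hr h2
  have hint : Integrable f ((R ⊗ₖ K).snd ∘ₘ E) :=
    Integrable.of_bound hf.aestronglyMeasurable _ hbound
  have hint1 := (Measure.integrable_comp_iff hint.1).1 hint
  unfold weightedReturn actionValue
  rw [hlaw]
  rw [Measure.comp_eq_comp_const_apply] at hint ⊢
  refine (Kernel.integral_comp hint).trans ?_
  rw [Kernel.const_apply]
  refine integral_congr_ae ?_
  filter_upwards [hint1.1] with x hx
  rw [Kernel.snd_apply] at hx ⊢
  rw [integral_map measurable_snd.aemeasurable hf.aestronglyMeasurable]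
  have hx' := (integrable_map_measure hf.aestronglyMeasurable measurable_snd.aemeasurable).1 hx
  refine (integral_compProd hx').trans ?_
  have e1 : ∀ r, ∫ h, f h ∂(K (x, r)) =
      g x * (r + contValue M ν n (k + 1) (u, Past.snoc o x, Past.snoc taken a, prop)) := by
    intro r
    rw [integral_congr_ae (hae x r), integral_mul_const, mul_comm]
    congr 1
    have h1 := integral_pathLaw M ν (k + 1) n
      (settingTraj k u (Past.snoc o x) (Past.snoc taken a) prop r)
    refine (integral_add (integrable_const r) (integrable_returnFrom M ν (k + 1) n _)).trans ?_
    rw [h1]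
    simp only [integral_const, probReal_univ, one_smul]
    rfl
  refine (integral_congr_ae (Filter.Eventually.of_forall e1)).trans ?_
  rw [integral_const_mul, integral_add _ (integrable_const _)]
  · simp only [integral_const, probReal_univ, one_smul]
    rfl
  · exact Integrable.of_bound measurable_id.aestronglyMeasurable M.rewardBound (M.reward_le _ _)

end PathLaw

/-! ### Tower property and finite-valued substitutions. -/

section Helpers

theorem comap_le_comap_of_eq_comp {Ω α β : Type*} [MeasurableSpace α] [MeasurableSpace β]
    {V : Ω → α} {X : Ω → β} {φ : β → α} (hφ : Measurable φ) (h : ∀ ω, V ω = φ (X ω)) :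
    MeasurableSpace.comap V inferInstance ≤ MeasurableSpace.comap X inferInstance := by
  rintro _ ⟨s, hs, rfl⟩
  exact ⟨φ ⁻¹' s, hφ hs, by ext ω; simp [h]⟩

/-- The tower property in the form used to integrate out one variable at a time along a decreasing
chain of σ-algebras. -/
theorem condExp_congr_of_condExp {Ω : Type*} {m₁ m₂ mΩ : MeasurableSpace Ω} {P : Measure Ω}
    [IsFiniteMeasure P] (h₁₂ : m₁ ≤ m₂) (h₂ : m₂ ≤ mΩ) {f g : Ω → ℝ}
    (h : P[f | m₂] =ᵐ[P] g) : P[f | m₁] =ᵐ[P] P[g | m₁] :=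
  (condExp_condExp_of_le h₁₂ h₂).symm.trans (condExp_congr_ae h)

/-- Split over the finitely many values of Y. This is needed because bridge functions are integrable
only for fixed proposals, while the equations insert the random action. -/
theorem integrable_comp_of_finite {Ω α : Type*} [MeasurableSpace Ω] [MeasurableSpace α]
    [MeasurableSingletonClass α] [Fintype α] {P : Measure Ω} {Y : Ω → α} (hY : Measurable Y)
    {g : α → Ω → ℝ} (hg : ∀ a, Integrable (g a) P) : Integrable (fun ω => g (Y ω) ω) P := by
  classical
  have : (fun ω => g (Y ω) ω) = fun ω => ∑ a, (Y ⁻¹' {a}).indicator (g a) ω := by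
    funext ω
    rw [Finset.sum_eq_single (Y ω)]
    · simp
    · intro a _ ha
      simp [ha.symm]
    · simp
  rw [this]
  exact integrable_finsetSum _ fun a _ => (hg a).indicator (hY (measurableSet_singleton a))

/-- Remove the last value. -/
def Past.init {X : ℕ → Type*} {k : ℕ} (p : Past X (k + 1)) : Past X k := fun i => p i.castSucc

/-- The last value. -/
def Past.last {X : ℕ → Type*} {k : ℕ} (p : Past X (k + 1)) : X k := p (Fin.last k)

@[fun_prop]
theorem measurable_pastInit {X : ℕ → Type*} [∀ k, MeasurableSpace (X k)] {k : ℕ} :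
    Measurable (Past.init : Past X (k + 1) → Past X k) :=
  measurable_pi_iff.2 fun i => measurable_pi_apply i.castSucc

@[fun_prop]
theorem measurable_pastLast {X : ℕ → Type*} [∀ k, MeasurableSpace (X k)] {k : ℕ} :
    Measurable (Past.last : Past X (k + 1) → X k) :=
  measurable_pi_apply (Fin.last k)

end Helpers

/-! ### Conditional means of bridge functions under the offline law. -/

section Offline

variable {O U A : ℕ → Type*} [∀ k, MeasurableSpace (O k)] [∀ k, MeasurableSpace (U k)]
  [∀ k, MeasurableSpace (A k)]
  {M : ConfoundedProcess O U A} {T : ℕ} {O₀ : Type*} [MeasurableSpace O₀]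
  {Ω : Type*} [MeasurableSpace Ω] {P : Measure Ω}

namespace OfflineData

/-- `(U_{0:k}, O_{0:k-1}, A_{0:k-1})`. -/
def ctxVar (D : OfflineData M T O₀ P) (k : ℕ) (ω : Ω) : Past U (k + 1) × Past O k × Past A k :=
  (pastOf D.lat (k + 1) ω, pastOf D.obs k ω, pastOf D.act k ω)

/-- `(U_{0:k-1}, O_{0:k-1}, A_{0:k-1})`. -/
def histVar (D : OfflineData M T O₀ P) (k : ℕ) (ω : Ω) : Past U k × Past O k × Past A k :=
  (pastOf D.lat k ω, pastOf D.obs k ω, pastOf D.act k ω)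

/-- The variables that determine the law of the `k`-th action. -/
def actVar (D : OfflineData M T O₀ P) (k : ℕ) (ω : Ω) :
    (Past U (k + 1) × Past A k) × Past O (k + 1) × O₀ :=
  ((pastOf D.lat (k + 1) ω, pastOf D.act k ω), pastOf D.obs (k + 1) ω, D.obs₀ ω)

variable (D : OfflineData M T O₀ P)

theorem measurable_ctxVar (k : ℕ) : Measurable (D.ctxVar k) :=
  (measurable_pastOf D.measurable_lat _).prodMk
    ((measurable_pastOf D.measurable_obs _).prodMk (measurable_pastOf D.measurable_act _))

theorem measurable_histVar (k : ℕ) : Measurable (D.histVar k) :=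
  (measurable_pastOf D.measurable_lat _).prodMk
    ((measurable_pastOf D.measurable_obs _).prodMk (measurable_pastOf D.measurable_act _))

theorem measurable_actVar (k : ℕ) : Measurable (D.actVar k) :=
  ((measurable_pastOf D.measurable_lat _).prodMk (measurable_pastOf D.measurable_act _)).prodMk
    ((measurable_pastOf D.measurable_obs _).prodMk D.measurable_obs₀)

variable [IsProbabilityMeasure P]

/-- The action at time `k` does not change the law of the observation at time `k`. -/
theorem hasCondDistrib_obs {k : ℕ} (hk : k < T) :
    HasCondDistrib (D.obs k) (D.condVar k)
      ((M.emission k).comap (fun z : Past U (k + 1) × Past O k × Past A (k + 1) => z.1)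
        (by fun_prop)) P := by
  -- The behavior kernel ignores O_k and O₀, so conditioning may be coarsened to (U_{0:k},
  -- O_{0:k-1}, A_{0:k-1}) together with O_k, with a kernel that depends on the first part alone.
  have hact : HasCondDistrib (D.act k) (fun ω => (D.ctxVar k ω, D.obs k ω))
      (((M.behavior k).comap (fun w : Past U (k + 1) × Past O k × Past A k => (w.1, w.2.2))
        (by fun_prop)).comap (fun x : (Past U (k + 1) × Past O k × Past A k) × O k => x.1)
        (by fun_prop)) P :=
    HasCondDistrib.comp_right (Z := D.actVar k)
      (f := fun x : (Past U (k + 1) × Past A k) × Past O (k + 1) × O₀ =>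
        ((x.1.1, x.2.1.init, x.1.2), x.2.1.last)) (hf := by fun_prop) (D.law_act k hk)
  have h := HasCondDistrib.prodMk_of_comap_fst (D.measurable_ctxVar k) (D.measurable_obs k)
    (D.measurable_act k) (D.law_obs k hk) hact
  have h' := HasCondDistrib.comp_right (Z := fun ω => (D.ctxVar k ω, D.act k ω))
    (κ := (M.emission k).comap (fun z : Past U (k + 1) × Past O k × Past A (k + 1) => z.1)
        (by fun_prop))
    (f := fun x : (Past U (k + 1) × Past O k × Past A k) × A k =>
      (x.1.1, x.1.2.1, Past.snoc x.1.2.2 x.2)) (hf := by fun_prop) h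
  have e : D.condVar k = (fun x : (Past U (k + 1) × Past O k × Past A k) × A k =>
      (x.1.1, x.1.2.1, Past.snoc x.1.2.2 x.2)) ∘ fun ω => (D.ctxVar k ω, D.act k ω) := by
    funext ω
    simp [condVar, ctxVar, pastOf_succ D.act k]
  rw [e]
  exact h'

theorem condExp_obs {k : ℕ} (hk : k < T)
    {F : (Past U (k + 1) × Past O k × Past A (k + 1)) × O k → ℝ} (hF : Measurable F)
    (hint : Integrable (fun ω => F (D.condVar k ω, D.obs k ω)) P) :
    P[fun ω => F (D.condVar k ω, D.obs k ω) | MeasurableSpace.comap (D.condVar k) inferInstance]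
      =ᵐ[P] fun ω => ∫ x, F (D.condVar k ω, x) ∂(M.emission k (pastOf D.lat (k + 1) ω)) :=
  (D.hasCondDistrib_obs hk).condExp_comap (D.measurable_condVar k) hF hint

section Bridge

theorem SquareIntegrable.integrable {D : OfflineData M T O₀ P} {b : BridgeFun O A}
    (hb : D.SquareIntegrable b) {k : ℕ} (hk : k < T) (a : A k) (prop : Past A (k + 1)) :
    Integrable (fun ω => b k a (pastOf D.obs k ω) (pastOf D.act k ω) (D.obs k ω) prop) P :=
  (hb k hk a prop).2.integrable (by norm_num)

variable [∀ k, MeasurableSingletonClass (A k)] [∀ k, Fintype (A k)]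

/-- `∑_a b_k(a, (O_{0:k-1}, A_{0:k-1}), O_k, (prop, A_k))`. -/
def bridgeSum (b : BridgeFun O A) (k : ℕ) (prop : Past A k) (ω : Ω) : ℝ :=
  ∑ a, b k a (pastOf D.obs k ω) (pastOf D.act k ω) (D.obs k ω) (Past.snoc prop (D.act k ω))

/-- The mean of `bridgeSum` over the action. -/
def bridgeMean (b : BridgeFun O A) (k : ℕ) (prop : Past A k) (ω : Ω) : ℝ :=
  ∑ p, (M.behavior k (pastOf D.lat (k + 1) ω, pastOf D.act k ω)).real {p} *
    ∑ a, b k a (pastOf D.obs k ω) (pastOf D.act k ω) (D.obs k ω) (Past.snoc prop p)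

variable {D} {b : BridgeFun O A}

theorem SquareIntegrable.integrable_bridgeSum (hb : D.SquareIntegrable b) {k : ℕ} (hk : k < T)
    (prop : Past A k) : Integrable (D.bridgeSum b k prop) P :=
  integrable_comp_of_finite (D.measurable_act k)
    (g := fun p ω => ∑ a, b k a (pastOf D.obs k ω) (pastOf D.act k ω) (D.obs k ω)
      (Past.snoc prop p))
    fun _ => integrable_finsetSum _ fun a _ => hb.integrable hk a _

/-- The action A_k occurs only as the last proposal: the taken actions that b_k sees stop at k-1.
Its conditional law is the behavior policy, even when O_{0:k} and O₀ are also given. -/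
theorem SquareIntegrable.condExp_bridgeSum (hb : D.SquareIntegrable b) {k : ℕ} (hk : k < T)
    (prop : Past A k) :
    P[D.bridgeSum b k prop | MeasurableSpace.comap (D.actVar k) inferInstance]
      =ᵐ[P] D.bridgeMean b k prop := by
  let f : ((Past U (k + 1) × Past A k) × Past O (k + 1) × O₀) × A k → ℝ := fun y =>
    ∑ a, b k a y.1.2.1.init y.1.1.2 y.1.2.1.last (Past.snoc prop y.2)
  have hf : Measurable f := by
    -- Measurability is assumed only for each fixed proposal sequence; finiteness of `A k` makes it
    -- joint in the last proposal.
    refine measurable_from_prod_countable_left fun p => ?_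
    refine Finset.measurable_sum _ fun a _ => ?_
    exact (hb k hk a (Past.snoc prop p)).1.comp
      (g := fun z : Past O k × Past A k × O k => b k a z.1 z.2.1 z.2.2 (Past.snoc prop p))
      (f := fun y : (Past U (k + 1) × Past A k) × Past O (k + 1) × O₀ =>
        (y.2.1.init, y.1.2, y.2.1.last)) (by fun_prop)
  refine ((D.law_act k hk).condExp_comap (D.measurable_actVar k) hf
    (hb.integrable_bridgeSum hk prop)).trans (Filter.Eventually.of_forall fun ω => ?_)
  dsimp only
  rw [integral_fintype (Integrable.of_finite)]
  rfl

theorem SquareIntegrable.integrable_bridgeMean (hb : D.SquareIntegrable b) {k : ℕ} (hk : k < T)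
    (prop : Past A k) : Integrable (D.bridgeMean b k prop) P :=
  integrable_condExp.congr (hb.condExp_bridgeSum hk prop)

/-- `b` satisfies the defining equation of a value bridge function at time `k`. -/
def BridgeAt (D : OfflineData M T O₀ P) (ν : SuperPolicy O A) (b : BridgeFun O A) (k : ℕ) : Prop :=
  ∀ (prop : Past A (k + 1)) (a : A k), ∀ᵐ ω ∂P,
    weightedReturn M T ν k (pastOf D.lat (k + 1) ω) (pastOf D.obs k ω) (pastOf D.act k ω) prop a =
      ∫ x, b k a (pastOf D.obs k ω) (pastOf D.act k ω) x prop
        ∂(M.emission k (pastOf D.lat (k + 1) ω))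

variable {ν : SuperPolicy O A}

/-- The mean of the bridge functions at time `k` is the expected return under `ν`. -/
theorem SquareIntegrable.condExp_bridgeMean (hb : D.SquareIntegrable b) {k : ℕ} (hk : k < T)
    (h : D.BridgeAt ν b k) (prop : Past A k) :
    P[D.bridgeMean b k prop | MeasurableSpace.comap (D.histVar k) inferInstance]
      =ᵐ[P] fun ω => contValue M ν (T - k) k
        (pastOf D.lat k ω, pastOf D.obs k ω, pastOf D.act k ω, prop) := by
  -- The truncated subtraction is written as a successor, so that `contValue` unfolds to
  -- `proposalValue`.
  have hT : T - k = (T - (k + 1)) + 1 := by omega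
  let q : A k → Past U (k + 1) × Past O k × Past A k × Past A (k + 1) → ℝ := fun a =>
    actionValue M ν k (contValue M ν (T - (k + 1)) (k + 1)) a
  have hq : ∀ a, BoundedMeasurable (q a) := fun a =>
    boundedMeasurable_actionValue M ν k (boundedMeasurable_contValue M ν _ _) a
  have hbm : ∀ a p, Measurable fun y : (Past U (k + 1) × Past O k × Past A k) × O k =>
      b k a y.1.2.1 y.1.2.2 y.2 (Past.snoc prop p) := fun a p =>
    (hb k hk a (Past.snoc prop p)).1.comp
      (g := fun z : Past O k × Past A k × O k => b k a z.1 z.2.1 z.2.2 (Past.snoc prop p))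
      (f := fun y : (Past U (k + 1) × Past O k × Past A k) × O k =>
        (y.1.2.1, y.1.2.2, y.2)) (by fun_prop)
  have hβ : ∀ p, BoundedMeasurable fun w : Past U (k + 1) × Past O k × Past A k =>
      (M.behavior k (w.1, w.2.2)).real {p} := fun p =>
    (boundedMeasurable_kernel_real (M.behavior k) (measurableSet_singleton p)).comp (by fun_prop)
  -- the observation at time `k` is integrated out
  have step1 : P[D.bridgeMean b k prop | MeasurableSpace.comap (D.ctxVar k) inferInstance]
      =ᵐ[P] fun ω => ∑ p, (M.behavior k (pastOf D.lat (k + 1) ω, pastOf D.act k ω)).real {p} *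
        ∑ a, q a (pastOf D.lat (k + 1) ω, pastOf D.obs k ω, pastOf D.act k ω,
          Past.snoc prop p) := by
    let f : (Past U (k + 1) × Past O k × Past A k) × O k → ℝ := fun y =>
      ∑ p, (M.behavior k (y.1.1, y.1.2.2)).real {p} *
        ∑ a, b k a y.1.2.1 y.1.2.2 y.2 (Past.snoc prop p)
    have hf : Measurable f := by
      refine Finset.measurable_sum _ fun p _ => Measurable.mul ?_
        (Finset.measurable_sum _ fun a _ => hbm a p)
      exact (hβ p).1.comp measurable_fst
    refine ((D.law_obs k hk).condExp_comap (D.measurable_ctxVar k) hf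
      (hb.integrable_bridgeMean hk prop)).trans ?_
    -- Sections of an integrable function are integrable only almost surely; finitely many
    -- exceptional sets are collected before sums and integrals are exchanged.
    have hi : ∀ᵐ ω ∂P, ∀ p a, Integrable (fun x => b k a (pastOf D.obs k ω) (pastOf D.act k ω) x
        (Past.snoc prop p)) (M.emission k (pastOf D.lat (k + 1) ω)) := by
      refine ae_all_iff.2 fun p => ae_all_iff.2 fun a => ?_
      exact (D.law_obs k hk).ae_integrable (hbm a p) (hb.integrable hk a _)
    have hbr : ∀ᵐ ω ∂P, ∀ p a, q a (pastOf D.lat (k + 1) ω, pastOf D.obs k ω, pastOf D.act k ω,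
          Past.snoc prop p) = ∫ x, b k a (pastOf D.obs k ω) (pastOf D.act k ω) x
        (Past.snoc prop p) ∂(M.emission k (pastOf D.lat (k + 1) ω)) := by
      refine ae_all_iff.2 fun p => ae_all_iff.2 fun a => ?_
      filter_upwards [h (Past.snoc prop p) a] with ω hω
      rw [← hω, weightedReturn_eq]
    filter_upwards [hi, hbr] with ω hi hbr
    simp only [f, ctxVar, Kernel.comap_apply]
    rw [integral_finsetSum _ fun p _ => (integrable_finsetSum _ fun a _ => hi p a).const_mul _]
    refine Finset.sum_congr rfl fun p _ => ?_
    rw [integral_const_mul, integral_finsetSum _ fun a _ => hi p a]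
    congr 1
    exact Finset.sum_congr rfl fun a _ => (hbr p a).symm
  refine (condExp_congr_of_condExp (comap_le_comap_of_eq_comp
    (φ := fun w : Past U (k + 1) × Past O k × Past A k => (w.1.init, w.2.1, w.2.2)) (by fun_prop)
    fun ω => rfl) (D.measurable_ctxVar k).comap_le step1).trans ?_
  -- the latent feature at time `k` is integrated out
  let f : (Past U k × Past O k × Past A k) × U k → ℝ := fun y =>
    ∑ p, (M.behavior k (Past.snoc y.1.1 y.2, y.1.2.2)).real {p} *
      ∑ a, q a (Past.snoc y.1.1 y.2, y.1.2.1, y.1.2.2, Past.snoc prop p)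
  have hf : BoundedMeasurable f :=
    (boundedMeasurable_proposalValue_integrand M k hq).comp
      (g := fun y : (Past U k × Past O k × Past A k) × U k =>
        ((y.1.1, y.1.2.1, y.1.2.2, prop), y.2)) (by fun_prop)
  have e : (fun ω => ∑ p, (M.behavior k (pastOf D.lat (k + 1) ω, pastOf D.act k ω)).real {p} *
        ∑ a, q a (pastOf D.lat (k + 1) ω, pastOf D.obs k ω, pastOf D.act k ω,
          Past.snoc prop p)) = fun ω => f (D.histVar k ω, D.lat k ω) := by
    funext ω
    simp only [f, histVar, pastOf_succ]
  rw [e, hT]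
  exact (D.law_lat k hk).condExp_comap (D.measurable_histVar k) hf.1
    ((hf.comp ((D.measurable_histVar k).prodMk (D.measurable_lat k))).integrable P)

end Bridge

end OfflineData

end Offline

/-! ### The residual of the moment equations and the bridge gap. -/

section Residual

variable {O U A : ℕ → Type*} [∀ k, MeasurableSpace (O k)] [∀ k, MeasurableSpace (U k)]
  [∀ k, MeasurableSpace (A k)]
  {M : ConfoundedProcess O U A} {T : ℕ} {O₀ : Type*} [MeasurableSpace O₀]
  {Ω : Type*} [MeasurableSpace Ω] {P : Measure Ω}

namespace OfflineData

/-- The σ-algebra generated by `(U_{0:k}, O_{0:k-1}, A_{0:k})` and `O₀`. -/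
@[reducible] def sigmaFull (D : OfflineData M T O₀ P) (k : ℕ) : MeasurableSpace Ω :=
  MeasurableSpace.comap (fun ω => (D.condVar k ω, D.obs₀ ω)) inferInstance

theorem comap_condVar_le_histVar (D : OfflineData M T O₀ P) (k : ℕ) :
    MeasurableSpace.comap (D.condVar k) inferInstance
      ≤ MeasurableSpace.comap (D.histVar (k + 1)) inferInstance :=
  comap_le_comap_of_eq_comp
    (φ := fun w : Past U (k + 1) × Past O (k + 1) × Past A (k + 1) => (w.1, w.2.1.init, w.2.2))
    (by fun_prop) fun _ => rfl

/-- Since `actVar` contains O₀, the action A_{k+1} can be integrated out before O₀ is removed. -/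
theorem sigmaFull_le_actVar (D : OfflineData M T O₀ P) (k : ℕ) :
    D.sigmaFull k ≤ MeasurableSpace.comap (D.actVar (k + 1)) inferInstance :=
  comap_le_comap_of_eq_comp
    (φ := fun w : (Past U (k + 1 + 1) × Past A (k + 1)) × Past O (k + 1 + 1) × O₀ =>
      ((w.1.1.init, w.2.1.init.init, w.1.2), w.2.2)) (by fun_prop) fun _ => rfl

theorem ae_abs_rew_le (D : OfflineData M T O₀ P) {k : ℕ} (hk : k < T) :
    ∀ᵐ ω ∂P, |D.rew k ω| ≤ M.rewardBound := by
  have h := D.law_rew k hk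
  have hm : MeasurableSet {y : (Past U (k + 1) × Past O (k + 1) × Past A (k + 1)) × ℝ |
      |y.2| ≤ M.rewardBound} := measurableSet_le (by fun_prop) (by fun_prop)
  refine ae_of_ae_map (p := fun y : (Past U (k + 1) × Past O (k + 1) × Past A (k + 1)) × ℝ =>
      |y.2| ≤ M.rewardBound) h.aemeasurable ?_
  rw [HasLaw.map_eq h]
  exact Measure.ae_compProd_of_ae_ae hm (Filter.Eventually.of_forall fun z => M.reward_le k z)

variable {D : OfflineData M T O₀ P} {ν : SuperPolicy O A} {b : BridgeFun O A}

theorem isValueBridge_iff : D.IsValueBridge ν b ↔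
    D.SquareIntegrable b ∧ ∀ k < T, D.BridgeAt ν b k := Iff.rfl

/-- Given `(U_{0:k}, O_{0:k-1}, A_{0:k})`, the observation `O₀` carries no information on
functions of `(R_k, O_{k+1}, O_k, U_{k+1})`. -/
theorem PreObservationIndep.condExp_eq [StandardBorelSpace Ω]
    [IsProbabilityMeasure P] (hindep : D.PreObservationIndep) {k : ℕ} (hk : k < T)
    {F : (Past U (k + 1) × Past O k × Past A (k + 1)) × (ℝ × O (k + 1) × O k × U (k + 1)) → ℝ}
    (hF : Measurable F)
    (hint : Integrable (fun ω => F (D.condVar k ω,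
      (D.rew k ω, D.obs (k + 1) ω, D.obs k ω, D.lat (k + 1) ω))) P) :
    P[fun ω => F (D.condVar k ω, (D.rew k ω, D.obs (k + 1) ω, D.obs k ω, D.lat (k + 1) ω)) |
        D.sigmaFull k]
      =ᵐ[P] P[fun ω => F (D.condVar k ω,
        (D.rew k ω, D.obs (k + 1) ω, D.obs k ω, D.lat (k + 1) ω)) |
        MeasurableSpace.comap (D.condVar k) inferInstance] :=
  condExp_prodMk_of_condIndepFun (D.measurable_condVar k)
    ((D.measurable_rew k).prodMk ((D.measurable_obs _).prodMk
      ((D.measurable_obs _).prodMk (D.measurable_lat _)))) D.measurable_obs₀ (hindep k hk) hF hint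

theorem PreObservationIndep.condExp_obs [StandardBorelSpace Ω]
    [IsProbabilityMeasure P] (hindep : D.PreObservationIndep) {k : ℕ} (hk : k < T)
    {F : (Past U (k + 1) × Past O k × Past A (k + 1)) × O k → ℝ} (hF : Measurable F)
    (hint : Integrable (fun ω => F (D.condVar k ω, D.obs k ω)) P) :
    P[fun ω => F (D.condVar k ω, D.obs k ω) | D.sigmaFull k]
      =ᵐ[P] fun ω => ∫ x, F (D.condVar k ω, x) ∂(M.emission k (pastOf D.lat (k + 1) ω)) :=
  (hindep.condExp_eq hk (F := fun y => F (y.1, y.2.2.2.1)) (by fun_prop) hint).trans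
    (D.condExp_obs hk hF hint)

variable [∀ k, MeasurableSingletonClass (A k)]

/-- `ν_k(a | O_{0:k}, A_{0:k-1}, prop)`. -/
def policyWeight (D : OfflineData M T O₀ P) (ν : SuperPolicy O A) (k : ℕ) (a : A k)
    (prop : Past A (k + 1)) (ω : Ω) : ℝ :=
  ν.prob k a (pastOf D.obs (k + 1) ω) (pastOf D.act k ω) prop

theorem boundedMeasurable_policyWeight (D : OfflineData M T O₀ P) (ν : SuperPolicy O A) (k : ℕ)
    (a : A k) (prop : Past A (k + 1)) : BoundedMeasurable (D.policyWeight ν k a prop) :=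
  (boundedMeasurable_prob ν k a).comp (g := fun ω =>
    (pastOf D.obs (k + 1) ω, pastOf D.act k ω, prop))
    ((measurable_pastOf D.measurable_obs _).prodMk
      ((measurable_pastOf D.measurable_act _).prodMk measurable_const))

theorem integrable_mul_policyWeight (D : OfflineData M T O₀ P) (ν : SuperPolicy O A) (k : ℕ)
    (a : A k) (prop : Past A (k + 1)) {f : Ω → ℝ} (hf : Integrable f P) :
    Integrable (fun ω => f ω * D.policyWeight ν k a prop ω) P := by
  obtain ⟨hm, C, hC⟩ := D.boundedMeasurable_policyWeight ν k a prop
  exact hf.mul_bdd hm.aestronglyMeasurable (Filter.Eventually.of_forall hC)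

/-- The weighted mean of a bounded function of `(U_{0:k}, O_{0:k}, A_{0:k})`. -/
theorem condExp_hist [IsProbabilityMeasure P] (D : OfflineData M T O₀ P) {k : ℕ} (hk : k < T)
    (a : A k) (prop : Past A (k + 1))
    {c : Past U (k + 1) × Past O (k + 1) × Past A (k + 1) → ℝ} (hc : BoundedMeasurable c) :
    P[fun ω => c (D.histVar (k + 1) ω) * D.policyWeight ν k a prop ω |
        MeasurableSpace.comap (D.condVar k) inferInstance]
      =ᵐ[P] fun ω => ∫ x, ν.prob k a (Past.snoc (pastOf D.obs k ω) x) (pastOf D.act k ω) prop *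
        c (pastOf D.lat (k + 1) ω, Past.snoc (pastOf D.obs k ω) x, pastOf D.act (k + 1) ω)
        ∂(M.emission k (pastOf D.lat (k + 1) ω)) := by
  let F : (Past U (k + 1) × Past O k × Past A (k + 1)) × O k → ℝ := fun y =>
    ν.prob k a (Past.snoc y.1.2.1 y.2) y.1.2.2.init prop *
      c (y.1.1, Past.snoc y.1.2.1 y.2, y.1.2.2)
  have hF : BoundedMeasurable F := by
    refine BoundedMeasurable.mul ?_ (hc.comp (by fun_prop))
    exact (boundedMeasurable_prob ν k a).comp
      (g := fun y : (Past U (k + 1) × Past O k × Past A (k + 1)) × O k =>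
        (Past.snoc y.1.2.1 y.2, y.1.2.2.init, prop)) (by fun_prop)
  have e : (fun ω => c (D.histVar (k + 1) ω) * D.policyWeight ν k a prop ω) =
      fun ω => F (D.condVar k ω, D.obs k ω) := by
    funext ω
    rw [mul_comm]
    simp only [F, policyWeight, histVar, condVar, pastOf_succ D.obs]
    rfl
  rw [e]
  exact D.condExp_obs hk hF.1
    ((hF.comp ((D.measurable_condVar k).prodMk (D.measurable_obs k))).integrable P)

/-- The conditioning variables omit O_k, on which the weight depends. Hence reward and weight are
treated jointly when O₀ is dropped; then R_k is averaged given O_k, and O_k last. -/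
theorem PreObservationIndep.condExp_rew [StandardBorelSpace Ω]
    [IsProbabilityMeasure P] (hindep : D.PreObservationIndep) {k : ℕ} (hk : k < T)
    (a : A k) (prop : Past A (k + 1)) :
    P[fun ω => D.rew k ω * D.policyWeight ν k a prop ω | D.sigmaFull k]
      =ᵐ[P] fun ω => ∫ x, ν.prob k a (Past.snoc (pastOf D.obs k ω) x) (pastOf D.act k ω) prop *
        rewardMean M k
          (pastOf D.lat (k + 1) ω, Past.snoc (pastOf D.obs k ω) x, pastOf D.act (k + 1) ω)
        ∂(M.emission k (pastOf D.lat (k + 1) ω)) := by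
  have hr : Integrable (D.rew k) P := Integrable.of_bound (D.measurable_rew k).aestronglyMeasurable
    M.rewardBound (D.ae_abs_rew_le hk)
  have hint := D.integrable_mul_policyWeight ν k a prop hr
  let F : (Past U (k + 1) × Past O k × Past A (k + 1)) × (ℝ × O (k + 1) × O k × U (k + 1)) → ℝ :=
    fun y => y.2.1 * ν.prob k a (Past.snoc y.1.2.1 y.2.2.2.1) y.1.2.2.init prop
  have hF : Measurable F := Measurable.mul (by fun_prop)
    ((boundedMeasurable_prob ν k a).comp
      (g := fun y : (Past U (k + 1) × Past O k × Past A (k + 1)) ×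
        (ℝ × O (k + 1) × O k × U (k + 1)) =>
        (Past.snoc y.1.2.1 y.2.2.2.1, y.1.2.2.init, prop)) (by fun_prop)).1
  have e : (fun ω => D.rew k ω * D.policyWeight ν k a prop ω) = fun ω => F (D.condVar k ω,
      (D.rew k ω, D.obs (k + 1) ω, D.obs k ω, D.lat (k + 1) ω)) := by
    funext ω
    simp only [F, policyWeight, condVar, pastOf_succ D.obs]
    rfl
  have h1 := hindep.condExp_eq hk hF (e ▸ hint)
  rw [← e] at h1
  refine h1.trans ?_
  let G : (Past U (k + 1) × Past O (k + 1) × Past A (k + 1)) × ℝ → ℝ :=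
    fun y => y.2 * ν.prob k a y.1.2.1 y.1.2.2.init prop
  have hG : Measurable G := Measurable.mul (by fun_prop)
    ((boundedMeasurable_prob ν k a).comp
      (g := fun y : (Past U (k + 1) × Past O (k + 1) × Past A (k + 1)) × ℝ =>
        (y.1.2.1, y.1.2.2.init, prop)) (by fun_prop)).1
  have h2 : P[fun ω => D.rew k ω * D.policyWeight ν k a prop ω |
      MeasurableSpace.comap (D.histVar (k + 1)) inferInstance] =ᵐ[P]
      fun ω => rewardMean M k (D.histVar (k + 1) ω) * D.policyWeight ν k a prop ω := by
    refine ((D.law_rew k hk).condExp_comap (D.measurable_histVar (k + 1)) hG hint).trans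
      (Filter.Eventually.of_forall fun ω => ?_)
    exact integral_mul_const (D.policyWeight ν k a prop ω) fun r : ℝ => r
  exact (condExp_congr_of_condExp (D.comap_condVar_le_histVar k)
    (D.measurable_histVar (k + 1)).comap_le h2).trans
    (D.condExp_hist hk a prop (boundedMeasurable_rewardMean M k))

variable [∀ k, Fintype (A k)]

/-- The difference of the two sides of the equation that defines a value bridge function. -/
def bridgeGap (M : ConfoundedProcess O U A) (T : ℕ) (ν : SuperPolicy O A) (b : BridgeFun O A)
    (k : ℕ) (a : A k) (prop : Past A (k + 1)) (w : Past U (k + 1) × Past O k × Past A k) : ℝ :=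
  ∫ x, b k a w.2.1 w.2.2 x prop ∂(M.emission k w.1) -
    actionValue M ν k (contValue M ν (T - (k + 1)) (k + 1)) a (w.1, w.2.1, w.2.2, prop)

theorem bridgeAt_iff {k : ℕ} : D.BridgeAt ν b k ↔
    ∀ (prop : Past A (k + 1)) (a : A k),
      (fun ω => bridgeGap M T ν b k a prop (pastOf D.lat (k + 1) ω, pastOf D.obs k ω,
        pastOf D.act k ω)) =ᵐ[P] 0 := by
  refine forall_congr' fun prop => forall_congr' fun a => ?_
  refine Filter.eventually_congr (Filter.Eventually.of_forall fun ω => ?_)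
  rw [weightedReturn_eq]
  simp only [bridgeGap, Pi.zero_apply, sub_eq_zero]
  exact eq_comm

theorem measurable_bridgeGap (hb : D.SquareIntegrable b) {k : ℕ} (hk : k < T) (a : A k)
    (prop : Past A (k + 1)) : Measurable (bridgeGap M T ν b k a prop) := by
  refine Measurable.sub ?_ ?_
  · have h : Measurable fun y : (Past U (k + 1) × Past O k × Past A k) × O k =>
        b k a y.1.2.1 y.1.2.2 y.2 prop :=
      (hb k hk a prop).1.comp (f := fun y : (Past U (k + 1) × Past O k × Past A k) × O k =>
        (y.1.2.1, y.1.2.2, y.2)) (by fun_prop)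
    exact (h.stronglyMeasurable.integral_kernel_prod_right' (κ := (M.emission k).comap
      (fun w : Past U (k + 1) × Past O k × Past A k => w.1) (by fun_prop))).measurable
  · exact ((boundedMeasurable_actionValue M ν k (boundedMeasurable_contValue M ν _ _) a).comp
      (by fun_prop)).1

variable [IsProbabilityMeasure P]

theorem integrable_nextBridge (hb : D.SquareIntegrable b) (k : ℕ) (prop : Past A (k + 1)) :
    Integrable (D.nextBridge b k prop) P := by
  by_cases hk : k + 1 < T
  · have : D.nextBridge b k prop = D.bridgeSum b (k + 1) prop := by
      funext ω; simp [nextBridge, hk, bridgeSum]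
    rw [this]
    exact hb.integrable_bridgeSum hk prop
  · have : D.nextBridge b k prop = fun _ => 0 := by
      funext ω; simp [nextBridge, hk]
    rw [this]
    exact integrable_const _

/-- The emission mean of b_k is a conditional expectation of a square-integrable variable, and
`actionValue` is bounded. This makes the gap admissible in the completeness assumption. -/
theorem memLp_bridgeGap (hb : D.SquareIntegrable b) {k : ℕ} (hk : k < T) (a : A k)
    (prop : Past A (k + 1)) :
    MemLp (fun ω => bridgeGap M T ν b k a prop (pastOf D.lat (k + 1) ω, pastOf D.obs k ω,
        pastOf D.act k ω)) 2 P := by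
  refine MemLp.sub ?_ ?_
  · have h : Measurable fun y : (Past U (k + 1) × Past O k × Past A k) × O k =>
        b k a y.1.2.1 y.1.2.2 y.2 prop :=
      (hb k hk a prop).1.comp (f := fun y : (Past U (k + 1) × Past O k × Past A k) × O k =>
        (y.1.2.1, y.1.2.2, y.2)) (by fun_prop)
    exact ((hb k hk a prop).2.condExp (by norm_num)).ae_eq
      ((D.law_obs k hk).condExp_comap (D.measurable_ctxVar k) h (hb.integrable hk a prop))
  · obtain ⟨hm, C, hC⟩ := boundedMeasurable_actionValue M ν k
      (boundedMeasurable_contValue M ν (T - (k + 1)) (k + 1)) a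
    refine MemLp.of_bound ?_ C (Filter.Eventually.of_forall fun ω => hC _)
    exact ((hm.comp (by fun_prop : Measurable fun w : Past U (k + 1) × Past O k × Past A k =>
      (w.1, w.2.1, w.2.2, prop))).comp (D.measurable_ctxVar k)).aestronglyMeasurable

/-- Integrating out A_0, then O_0 and U_0 turns the sum of the b_0 into `contValue` at the empty
context. All pasts of length zero coincide, so that value is a constant. -/
theorem IsValueBridge.value_eq (hT : 0 < T) (h : D.IsValueBridge ν b) :
    value M T ν = ∫ ω, ∑ a : A 0, b 0 a (fun i => i.elim0) (fun i => i.elim0) (D.obs 0 ω)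
          (pastOf D.act 1 ω) ∂P := by
  rw [isValueBridge_iff] at h
  let e₀ : ∀ {X : ℕ → Type _}, Past X 0 := fun i => i.elim0
  have h1 := h.1.condExp_bridgeSum hT (e₀ : Past A 0)
  have h2 := h.1.condExp_bridgeMean hT (h.2 0 hT) (e₀ : Past A 0)
  have e1 : ∀ ω, D.bridgeSum b 0 (e₀ : Past A 0) ω =
      ∑ a : A 0, b 0 a (fun i => i.elim0) (fun i => i.elim0) (D.obs 0 ω) (pastOf D.act 1 ω) := by
    intro ω
    unfold bridgeSum
    rw [pastOf_succ D.act 0]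
    have ho : pastOf D.obs 0 ω = fun i => i.elim0 := funext fun i => i.elim0
    have ha : pastOf D.act 0 ω = fun i => i.elim0 := funext fun i => i.elim0
    rw [ho, ha]
  rw [← integral_congr_ae (Filter.Eventually.of_forall e1),
    ← integral_condExp (D.measurable_actVar 0).comap_le, integral_congr_ae h1,
    ← integral_condExp (D.measurable_histVar 0).comap_le, integral_congr_ae h2, _root_.value_eq]
  have e2 : ∀ ω, contValue M ν (T - 0) 0
        (pastOf D.lat 0 ω, pastOf D.obs 0 ω, pastOf D.act 0 ω, (e₀ : Past A 0)) =
      contValue M ν T 0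
      (fun i => i.elim0, fun i => i.elim0, fun i => i.elim0, fun i => i.elim0) := by
    intro ω
    have hl : pastOf D.lat 0 ω = fun i => i.elim0 := funext fun i => i.elim0
    have ho : pastOf D.obs 0 ω = fun i => i.elim0 := funext fun i => i.elim0
    have ha : pastOf D.act 0 ω = fun i => i.elim0 := funext fun i => i.elim0
    rw [hl, ho, ha]
    rfl
  rw [integral_congr_ae (Filter.Eventually.of_forall e2)]
  simp

variable [StandardBorelSpace Ω]

/-- The order of integration is forced: the independence assumption does not mention A_{k+1}, so
this action must be averaged out while O₀ is still given. What remains depends only on `condVar`,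
O_{k+1}, O_k and U_{k+1}. After O₀ is dropped, the bridge property turns it into `contValue`, and
O_k is averaged last. -/
theorem PreObservationIndep.condExp_bridgeSum (hindep : D.PreObservationIndep) {k : ℕ}
    (hk : k + 1 < T) (hb : D.SquareIntegrable b) (h : D.BridgeAt ν b (k + 1))
    (a : A k) (prop : Past A (k + 1)) :
    P[fun ω => D.bridgeSum b (k + 1) prop ω * D.policyWeight ν k a prop ω | D.sigmaFull k]
      =ᵐ[P] fun ω => ∫ x, ν.prob k a (Past.snoc (pastOf D.obs k ω) x) (pastOf D.act k ω) prop *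
        contValue M ν (T - (k + 1)) (k + 1)
          (pastOf D.lat (k + 1) ω, Past.snoc (pastOf D.obs k ω) x, pastOf D.act (k + 1) ω, prop)
        ∂(M.emission k (pastOf D.lat (k + 1) ω)) := by
  have hint := D.integrable_mul_policyWeight ν k a prop (hb.integrable_bridgeSum hk prop)
  have hint' := D.integrable_mul_policyWeight ν k a prop (hb.integrable_bridgeMean hk prop)
  have hprob := boundedMeasurable_prob ν k a
  -- the action at time `k + 1` is integrated out
  have h1 : P[fun ω => D.bridgeSum b (k + 1) prop ω * D.policyWeight ν k a prop ω |
      MeasurableSpace.comap (D.actVar (k + 1)) inferInstance] =ᵐ[P]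
      fun ω => D.bridgeMean b (k + 1) prop ω * D.policyWeight ν k a prop ω := by
    -- The weight sees only O_{0:k} and A_{0:k-1}, so it pulls out of the average over A_{k+1}.
    have hw : StronglyMeasurable[MeasurableSpace.comap (D.actVar (k + 1)) inferInstance]
        (D.policyWeight ν k a prop) :=
      ((hprob.1.comp (by fun_prop :
        Measurable fun w : (Past U (k + 1 + 1) × Past A (k + 1)) × Past O (k + 1 + 1) × O₀ =>
          (w.2.1.init, w.1.2.init, prop))).comp
            (comap_measurable (D.actVar (k + 1)))).stronglyMeasurable
    filter_upwards [condExp_mul_of_stronglyMeasurable_right hw hint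
      (hb.integrable_bridgeSum hk prop), hb.condExp_bridgeSum hk prop] with ω h1 h2
    exact h1.trans (by rw [Pi.mul_apply, h2])
  refine (condExp_congr_of_condExp (D.sigmaFull_le_actVar k)
    (D.measurable_actVar (k + 1)).comap_le h1).trans ?_
  -- `O₀` is removed
  let F : (Past U (k + 1) × Past O k × Past A (k + 1)) × (ℝ × O (k + 1) × O k × U (k + 1)) → ℝ :=
    fun y => (∑ p, (M.behavior (k + 1) (Past.snoc y.1.1 y.2.2.2.2, y.1.2.2)).real {p} *
      ∑ a', b (k + 1) a' (Past.snoc y.1.2.1 y.2.2.2.1) y.1.2.2 y.2.2.1 (Past.snoc prop p)) *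
      ν.prob k a (Past.snoc y.1.2.1 y.2.2.2.1) y.1.2.2.init prop
  have hF : Measurable F := by
    refine Measurable.mul (Finset.measurable_sum _ fun p _ => Measurable.mul ?_
      (Finset.measurable_sum _ fun a' _ => ?_)) ?_
    · exact ((boundedMeasurable_kernel_real (M.behavior (k + 1))
        (measurableSet_singleton p)).comp (by fun_prop)).1
    · exact (hb (k + 1) hk a' (Past.snoc prop p)).1.comp
        (f := fun y : (Past U (k + 1) × Past O k × Past A (k + 1)) ×
        (ℝ × O (k + 1) × O k × U (k + 1)) => (Past.snoc y.1.2.1 y.2.2.2.1, y.1.2.2, y.2.2.1))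
        (by fun_prop)
    · exact (hprob.comp (g := fun y : (Past U (k + 1) × Past O k × Past A (k + 1)) ×
        (ℝ × O (k + 1) × O k × U (k + 1)) =>
        (Past.snoc y.1.2.1 y.2.2.2.1, y.1.2.2.init, prop)) (by fun_prop)).1
  have e : (fun ω => D.bridgeMean b (k + 1) prop ω * D.policyWeight ν k a prop ω) =
      fun ω => F (D.condVar k ω,
        (D.rew k ω, D.obs (k + 1) ω, D.obs k ω, D.lat (k + 1) ω)) := by
    funext ω
    simp only [F, bridgeMean, policyWeight, condVar, pastOf_succ D.obs k,
      pastOf_succ D.lat (k + 1)]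
    rfl
  have h2 := hindep.condExp_eq (k := k) (by omega) hF (e ▸ hint')
  rw [← e] at h2
  refine h2.trans ?_
  have h3 : P[fun ω => D.bridgeMean b (k + 1) prop ω * D.policyWeight ν k a prop ω |
      MeasurableSpace.comap (D.histVar (k + 1)) inferInstance] =ᵐ[P]
      fun ω => contValue M ν (T - (k + 1)) (k + 1) (pastOf D.lat (k + 1) ω,
        pastOf D.obs (k + 1) ω, pastOf D.act (k + 1) ω, prop) * D.policyWeight ν k a prop ω := by
    have hw : StronglyMeasurable[MeasurableSpace.comap (D.histVar (k + 1)) inferInstance]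
        (D.policyWeight ν k a prop) :=
      ((hprob.1.comp (by fun_prop :
        Measurable fun w : Past U (k + 1) × Past O (k + 1) × Past A (k + 1) =>
          (w.2.1, w.2.2.init, prop))).comp
            (comap_measurable (D.histVar (k + 1)))).stronglyMeasurable
    filter_upwards [condExp_mul_of_stronglyMeasurable_right hw hint'
      (hb.integrable_bridgeMean hk prop), hb.condExp_bridgeMean hk h prop] with ω h1 h2
    exact h1.trans (by rw [Pi.mul_apply, h2])
  exact (condExp_congr_of_condExp (D.comap_condVar_le_histVar k)
    (D.measurable_histVar (k + 1)).comap_le h3).trans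
    (D.condExp_hist (k := k) (by omega) a prop
      (c := fun z => contValue M ν (T - (k + 1)) (k + 1) (z.1, z.2.1, z.2.2, prop))
      ((boundedMeasurable_contValue M ν _ _).comp (by fun_prop)))

theorem PreObservationIndep.condExp_nextBridge (hindep : D.PreObservationIndep) {k : ℕ}
    (hb : D.SquareIntegrable b) (h : k + 1 < T → D.BridgeAt ν b (k + 1))
    (a : A k) (prop : Past A (k + 1)) :
    P[fun ω => D.nextBridge b k prop ω * D.policyWeight ν k a prop ω | D.sigmaFull k]
      =ᵐ[P] fun ω => ∫ x, ν.prob k a (Past.snoc (pastOf D.obs k ω) x) (pastOf D.act k ω) prop *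
        contValue M ν (T - (k + 1)) (k + 1)
          (pastOf D.lat (k + 1) ω, Past.snoc (pastOf D.obs k ω) x, pastOf D.act (k + 1) ω, prop)
        ∂(M.emission k (pastOf D.lat (k + 1) ω)) := by
  by_cases hk : k + 1 < T
  · have : D.nextBridge b k prop = D.bridgeSum b (k + 1) prop := by
      funext ω; simp [nextBridge, hk, bridgeSum]
    rw [this]
    exact hindep.condExp_bridgeSum hk hb (h hk) a prop
  · have h1 : (fun ω => D.nextBridge b k prop ω * D.policyWeight ν k a prop ω) = 0 := by
      funext ω; simp [nextBridge, hk]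
    have h2 : T - (k + 1) = 0 := by omega
    rw [h1, h2, condExp_zero]
    exact Filter.Eventually.of_forall fun ω => by simp [contValue]

/-- If `b` is a bridge function at time `k + 1`, the conditional mean of the residual of the
equation at time `k` is that of `bridgeGap`. -/
theorem PreObservationIndep.condExp_residual (hindep : D.PreObservationIndep) {k : ℕ} (hk : k < T)
    (hb : D.SquareIntegrable b) (h : k + 1 < T → D.BridgeAt ν b (k + 1))
    (a : A k) (prop : Past A (k + 1)) :
    (P[|D.act k ⁻¹' {a}])[fun ω =>
        b k a (pastOf D.obs k ω) (pastOf D.act k ω) (D.obs k ω) prop -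
          (D.rew k ω + D.nextBridge b k prop ω) *
            ν.prob k a (pastOf D.obs (k + 1) ω) (pastOf D.act k ω) prop | D.sigma k]
      =ᵐ[P[|D.act k ⁻¹' {a}]]
    (P[|D.act k ⁻¹' {a}])[fun ω => bridgeGap M T ν b k a prop
      (pastOf D.lat (k + 1) ω, pastOf D.obs k ω, pastOf D.act k ω) | D.sigma k] := by
  have hr : Integrable (D.rew k) P := Integrable.of_bound (D.measurable_rew k).aestronglyMeasurable
    M.rewardBound (D.ae_abs_rew_le hk)
  have hir := D.integrable_mul_policyWeight ν k a prop hr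
  have hin := D.integrable_mul_policyWeight ν k a prop (D.integrable_nextBridge hb k prop)
  have hib := hb.integrable hk a prop
  have hVm : Measurable fun ω => (D.condVar k ω, D.obs₀ ω) :=
    (D.measurable_condVar k).prodMk D.measurable_obs₀
  have hb1 : P[fun ω => b k a (pastOf D.obs k ω) (pastOf D.act k ω) (D.obs k ω) prop |
      D.sigmaFull k] =ᵐ[P] fun ω => ∫ x, b k a (pastOf D.obs k ω) (pastOf D.act k ω) x prop
        ∂(M.emission k (pastOf D.lat (k + 1) ω)) := by
    let F : (Past U (k + 1) × Past O k × Past A (k + 1)) × O k → ℝ := fun y =>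
      b k a y.1.2.1 y.1.2.2.init y.2 prop
    have hF : Measurable F := (hb k hk a prop).1.comp
      (f := fun y : (Past U (k + 1) × Past O k × Past A (k + 1)) × O k =>
        (y.1.2.1, y.1.2.2.init, y.2)) (by fun_prop)
    exact hindep.condExp_obs hk hF hib
  have hr1 := hindep.condExp_rew (ν := ν) hk a prop
  have hn1 := hindep.condExp_nextBridge hb h a prop
  have e : (fun ω => b k a (pastOf D.obs k ω) (pastOf D.act k ω) (D.obs k ω) prop -
          (D.rew k ω + D.nextBridge b k prop ω) *
            ν.prob k a (pastOf D.obs (k + 1) ω) (pastOf D.act k ω) prop) =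
      (fun ω => b k a (pastOf D.obs k ω) (pastOf D.act k ω) (D.obs k ω) prop) -
        ((fun ω => D.rew k ω * D.policyWeight ν k a prop ω) +
          fun ω => D.nextBridge b k prop ω * D.policyWeight ν k a prop ω) := by
    funext ω
    simp only [Pi.sub_apply, Pi.add_apply, policyWeight]
    ring
  have hsigma : D.sigma k ≤ D.sigmaFull k :=
    comap_le_comap_of_eq_comp
      (φ := fun w : (Past U (k + 1) × Past O k × Past A (k + 1)) × O₀ =>
        (w.2, w.1.2.1, w.1.2.2.init)) (by fun_prop) fun _ => rfl
  refine condExp_cond_congr (hsigma.trans hVm.comap_le) ?_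
    ((memLp_bridgeGap hb hk a prop).integrable (by norm_num)) fun t ht => ?_
  · rw [e]; exact hib.sub (hir.add hin)
  have hA : MeasurableSet (D.act k ⁻¹' {a}) := D.measurable_act k (measurableSet_singleton a)
  -- The event A_k = a belongs to `sigmaFull` though generally not to `sigma`, so conditional means
  -- given `sigmaFull` can be integrated over t ∩ {A_k = a}.
  have htA : MeasurableSet[D.sigmaFull k] (t ∩ D.act k ⁻¹' {a}) := by
    refine MeasurableSet.inter (hsigma _ ht) ?_
    exact ⟨(fun w : (Past U (k + 1) × Past O k × Past A (k + 1)) × O₀ => w.1.2.2.last) ⁻¹' {a},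
      (by fun_prop : Measurable fun w : (Past U (k + 1) × Past O k × Past A (k + 1)) × O₀ =>
        w.1.2.2.last) (measurableSet_singleton a), rfl⟩
  rw [e, ← setIntegral_condExp hVm.comap_le (hib.sub (hir.add hin)) htA]
  refine setIntegral_congr_ae (hVm.comap_le _ htA) ?_
  filter_upwards [condExp_sub hib (hir.add hin) (D.sigmaFull k),
    condExp_add hir hin (D.sigmaFull k), hb1, hr1, hn1] with ω h1 h2 h3 h4 h5 hω
  -- The event is used here: the offline history through time k is the past taken actions followed
  -- by a, as `actionValue` requires, while the proposals `prop` stay fixed.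
  have ha : pastOf D.act (k + 1) ω = Past.snoc (pastOf D.act k ω) a := by
    rw [pastOf_succ, show D.act k ω = a from hω.2]
  rw [h1, Pi.sub_apply, h2, Pi.add_apply, h3, h4, h5, ha, bridgeGap, actionValue]
  congr 1
  rw [← integral_add]
  · simp only [mul_add]
  · refine BoundedMeasurable.integrable (BoundedMeasurable.mul ?_ ?_) _
    · exact (boundedMeasurable_prob ν k a).comp (g := fun x : O k =>
        (Past.snoc (pastOf D.obs k ω) x, pastOf D.act k ω, prop)) (by fun_prop)
    · exact (boundedMeasurable_rewardMean M k).comp (by fun_prop)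
  · refine BoundedMeasurable.integrable (BoundedMeasurable.mul ?_ ?_) _
    · exact (boundedMeasurable_prob ν k a).comp (g := fun x : O k =>
        (Past.snoc (pastOf D.obs k ω) x, pastOf D.act k ω, prop)) (by fun_prop)
    · exact (boundedMeasurable_contValue M ν _ _).comp (by fun_prop)

theorem IsValueBridge.solves (hindep : D.PreObservationIndep) (h : D.IsValueBridge ν b) :
    D.SolvesBridgeEquations ν b := by
  rw [isValueBridge_iff] at h
  refine ⟨h.1, fun k hk prop a => ?_⟩
  refine (hindep.condExp_residual hk h.1 (fun hk' => h.2 _ hk') a prop).trans ?_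
  -- The gap vanishes P-almost surely, hence also under the law given A_k = a.
  have h0 := (cond_absolutelyContinuous (μ := P) (s := D.act k ⁻¹' {a})).ae_le
    (bridgeAt_iff.1 (h.2 k hk) prop a)
  refine (condExp_congr_ae h0).trans ?_
  rw [condExp_zero]

/-- Backward induction: the bridge property at k+1 makes the k-th equation say that the gap has zero
conditional mean, and completeness kills the gap. Completeness with g = 1 already excludes P(A_k =
a) = 0, where the equation would be vacuous. -/
theorem SolvesBridgeEquations.isValueBridge (hindep : D.PreObservationIndep)
    (hcomplete : D.Complete) (h : D.SolvesBridgeEquations ν b) : D.IsValueBridge ν b := by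
  refine isValueBridge_iff.2 ⟨h.1, ?_⟩
  -- Induction on the number of remaining decision points. At the last one there is no bridge
  -- property at k+1 to supply, since `nextBridge` is zero there.
  have key : ∀ n k, T - k = n → k < T → D.BridgeAt ν b k := by
    intro n
    induction n with
    | zero => intro k h1 h2; omega
    | succ n ih =>
      intro k h1 hk
      refine bridgeAt_iff.2 fun prop a => ?_
      refine (hcomplete k hk a _ (measurable_bridgeGap h.1 hk a prop)
        (memLp_bridgeGap h.1 hk a prop)).1 ?_
      exact (hindep.condExp_residual hk h.1 (fun hk' => ih (k + 1) (by omega) hk') a prop).symm.trans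
        (h.2 k hk prop a)
  exact fun k hk => key _ k rfl hk

end OfflineData

end Residual

end

theorem mainTheorem5 {O U A : ℕ → Type*}
    [∀ k, MeasurableSpace (O k)] [∀ k, MeasurableSpace (U k)]
    [∀ k, MeasurableSpace (A k)] [∀ k, MeasurableSingletonClass (A k)] [∀ k, Fintype (A k)]
    {O₀ : Type*} [MeasurableSpace O₀]
    {Ω : Type*} [MeasurableSpace Ω] [StandardBorelSpace Ω]
    (P : Measure Ω) [IsProbabilityMeasure P]
    (M : ConfoundedProcess O U A) (T : ℕ) (hT : 0 < T) (D : OfflineData M T O₀ P)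
    (hindep : D.PreObservationIndep)
    (hbridge : ∀ ν : SuperPolicy O A, ∃ b, D.IsValueBridge ν b)
    (hcomplete : D.Complete) :
    ∀ ν : SuperPolicy O A,
      (∃ b, D.SolvesBridgeEquations ν b) ∧
      (∀ b, D.IsValueBridge ν b ↔ D.SolvesBridgeEquations ν b) ∧
      (∀ b, D.SolvesBridgeEquations ν b →
        value M T ν = ∫ ω, ∑ a : A 0, b 0 a (fun i => i.elim0) (fun i => i.elim0) (D.obs 0 ω)
          (pastOf D.act 1 ω) ∂P) :=
  fun ν => ⟨(hbridge ν).imp fun _ hb => hb.solves hindep,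
    fun _ => ⟨fun hb => hb.solves hindep, fun hb => hb.isValueBridge hindep hcomplete⟩,
    fun _ hb => (hb.isValueBridge hindep hcomplete).value_eq hT⟩
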